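/- A radial weight is a function $\omega(z)=\omega(|z|)$ on the unit disc $\mathbb{D}$ whose profile is non-negative and belongs to $L^1([0,1))$, and such that $\widehat{\omega}(z)=\int_{|z|}^1\omega(s)\,ds>0$ for all $z\in\mathbb{D}$. A radial weight $\omega$ belongs to $\widehat{\mathcal{D}}$ if there is a constant $C>0$ such that $\widehat{\omega}(r)\le C\,\widehat{\omega}\left(\frac{1+r}{2}\right)$ for all $r<1$ sufficiently close to $1$; it belongs to $\widecheck{\mathcal{D}}$ if there are constants $K>1$ and $C>1$ such that $\widehat{\omega}(r)\ge C\,\widehat{\omega}\left(1-\frac{1-r}{K}\right)$ for all $r<1$ sufficiently close to $1$; and $\mathcal{D}=\widehat{\mathcal{D}}\cap\widecheck{\mathcal{D}}$. Let $dA=\frac{dx\,dy}{\pi}$, let $A^2_\omega$ be the space of analytic functions $f$ in $\mathbb{D}$ with $\int_{\mathbb{D}}|f|^2\omega\,dA<\infty$, and let $B^\omega_z$ be the reproducing kernel of $A^2_\omega$ at $z\in\mathbb{D}$, that is, $B^\omega_z\in A^2_\omega$ and $f(z)=\int_{\mathbb{D}}f(\zeta)\overline{B^\omega_z(\zeta)}\,\omega(\zeta)\,dA(\zeta)$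 for all $f\in A^2_\omega$. Let $2\le p<\infty$, let $N\ge 0$ be an integer, let $\omega\in\widehat{\mathcal{D}}$, and let $\nu$ be a radial weight. Then there exists a constant $C=C(\omega,\nu,p,N)>0$ such that $$\int_{\mathbb{D}}\left|(1-\overline{z}\zeta)^N B^\omega_z(\zeta)\right|^p\nu(\zeta)\,dA(\zeta)\le C\left(\int_0^{|z|}\frac{\widehat{\nu}(t)}{\widehat{\omega}(t)^p(1-t)^{p(1-N)}}\,dt+1\right),\quad z\in\mathbb{D}.$$ Moreover, if $\nu\in\mathcal{D}$, then there exist constants $c,C>0$, depending only on $\omega,\nu,p,N$, such that $$c\left(\int_0^{|z|}\frac{\widehat{\nu}(t)}{\widehat{\omega}(t)^p(1-t)^{p(1-N)}}\,dt+1\right)\le\int_{\mathbb{D}}\left|(1-\overline{z}\zeta)^N B^\omega_z(\zeta)\right|^p\nu(\zeta)\,dA(\zeta)\le C\left(\int_0^{|z|}\frac{\widehat{\nu}(t)}{\widehat{\omega}(t)^p(1-t)^{p(1-N)}}\,dt+1\right),\quad z\in\mathbb{D}.$$ -/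

import Mathlib

open MeasureTheory Set Filter Topology ComplexConjugate
open scoped ENNReal

noncomputable section

namespace RadialBergman

/-- The tail integral `ω̂(r) = ∫_r^1 ω(s) ds`. A radial function `ω(z) = ω(|z|)` on the unit disc is
represented by its profile, of which only the values on `[0, 1)` matter. -/
def tail (ω : ℝ → ℝ) (r : ℝ) : ℝ := ∫ s in r..1, ω s

/-- A radial weight: a non-negative function in `L¹([0, 1))` whose tail integral is strictly
positive at every point of `[0, 1)`. -/
structure IsRadialWeight (ω : ℝ → ℝ) : Prop where
  nonneg : ∀ r ∈ Ico (0 : ℝ) 1, 0 ≤ ω r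
  integrableOn : IntegrableOn ω (Ico 0 1) volume
  tail_pos : ∀ r ∈ Ico (0 : ℝ) 1, 0 < tail ω r

/-- The class `𝒟̂`: radial weights with `ω̂(r) ≤ C ω̂((1 + r) / 2)` as `r → 1⁻`. -/
def UpperDoubling : Set (ℝ → ℝ) :=
  {ω | IsRadialWeight ω ∧ ∃ C : ℝ, 0 < C ∧ ∀ᶠ r in 𝓝[<] (1 : ℝ), tail ω r ≤ C * tail ω ((1 + r) / 2)}

/-- The class `𝒟̌`: radial weights with `ω̂(r) ≥ C ω̂(1 - (1 - r) / K)` as `r → 1⁻`, for some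
`K > 1` and `C > 1`. -/
def LowerDoubling : Set (ℝ → ℝ) :=
  {ω | IsRadialWeight ω ∧ ∃ K C : ℝ, 1 < K ∧ 1 < C ∧
    ∀ᶠ r in 𝓝[<] (1 : ℝ), C * tail ω (1 - (1 - r) / K) ≤ tail ω r}

/-- The class `𝒟 = 𝒟̂ ∩ 𝒟̌`. -/
def TwoSidedDoubling : Set (ℝ → ℝ) := UpperDoubling ∩ LowerDoubling

/-- Normalized area measure `dA = dx dy / π` on the open unit disc. -/
def diskArea : Measure ℂ := (ENNReal.ofReal Real.pi)⁻¹ • volume.restrict (Metric.ball (0 : ℂ) 1)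

/-- The measure `ω dA` on the open unit disc. -/
def weightedArea (ω : ℝ → ℝ) : Measure ℂ :=
  diskArea.withDensity fun ζ => ENNReal.ofReal (ω ‖ζ‖)

/-- The weighted Bergman space `A^p_ω`: the functions in `L^p_ω` that are analytic in the open unit
disc. Values outside the disc are irrelevant. -/
def bergmanSpace (p : ℝ≥0∞) (ω : ℝ → ℝ) : Set (ℂ → ℂ) :=
  {f | DifferentiableOn ℂ f (Metric.ball 0 1) ∧ MemLp f p (weightedArea ω)}

/-- `K` is the reproducing kernel of the Hilbert space `A^2_ω` at the point `z`: it belongs to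
`A^2_ω` and `f(z) = ⟨f, K⟩_{L²_ω}` for every `f ∈ A^2_ω`. -/
def IsReproducingKernelAt (ω : ℝ → ℝ) (z : ℂ) (K : ℂ → ℂ) : Prop :=
  K ∈ bergmanSpace 2 ω ∧
    ∀ f ∈ bergmanSpace 2 ω, f z = ∫ ζ, f ζ * conj (K ζ) ∂(weightedArea ω)

/-- The Bergman kernel `B^ω_z`: the function with the reproducing property at `z`. For a radial
weight `ω` and `|z| < 1` it exists and is unique on the disc. -/
def bergmanKernel (ω : ℝ → ℝ) (z : ℂ) : ℂ → ℂ :=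
  Classical.epsilon (IsReproducingKernelAt ω z)

/-- `∫_𝔻 |(1 - z̄ ζ)^N B^ω_z(ζ)|^p ν(ζ) dA(ζ)`, with values in `[0, ∞]`. -/
def modifiedKernelIntegral (p : ℝ) (N : ℕ) (ω ν : ℝ → ℝ) (z : ℂ) : ℝ≥0∞ :=
  ∫⁻ ζ, ‖(1 - conj z * ζ) ^ N * bergmanKernel ω z ζ‖ₑ ^ p ∂(weightedArea ν)

/-- `∫_0^{x} ν̂(t) / (ω̂(t)^p (1 - t)^{p (1 - N)}) dt + 1`; for radial weights and `0 ≤ x < 1` the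
integrand is continuous on `[0, x]`. -/
def kernelBound (p : ℝ) (N : ℕ) (ω ν : ℝ → ℝ) (x : ℝ) : ℝ :=
  (∫ t in (0 : ℝ)..x, tail ν t / (tail ω t ^ p * (1 - t) ^ (p * (1 - (N : ℝ))))) + 1

end RadialBergman

end

/-!
The Bergman kernel of a radial weight is `B^ω_z(ζ) = B(z̄ ζ)` with `B(w) = ∑ a_n w^n` and
`a_n = 1 / (2 ∫_0^1 r^(2n+1) ω(r) dr)`. The proof rests on two-sided pointwise control of `B`.

**Upper estimate.** For `ω ∈ 𝒟̂` the odd moments of `ω` are comparable to `ω̂(1 - 1/(n+1))`, and their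
`j`-th differences are smaller by a factor `(n+1)^(-j)`. By the product rule the same is true of
the reciprocals `a_n` (`symbolBound_kernelCoeff`). With `δ = |1 - w|`, the terms of `B(w)` with
`n ≤ 1/δ` are summed trivially and the remaining ones after sufficiently many summations by parts; this
gives `|B(w)| ≤ C / (δ ω̂(1 - δ))` (`exists_norm_kernelFun_le`). Since `|1 - ρ e^{iθ}|` is comparable to
`max (1 - ρ) |θ|`, the mean of `|(1 - w)^N B(w)|^p` over the circle `|w| = ρ` is at most a constant times
`∫_0^ρ h(t) dt + 1` with `h(t) = ω̂(t)^(-p) (1 - t)^(-p(1-N))` (`exists_lintegral_circle_le`). Integration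
against `ν` and Tonelli's theorem turn `∫_0^{|z|s} h` into `∫_0^{|z|} ν̂ h`.

**Lower estimate.** The coefficients `a_n` are positive, increasing and slowly varying, so
`|B(w)| ≥ c / ((1 - ρ) ω̂(ρ))` on the arc `w = ρ e^{iθ}`, `|θ| ≤ ε (1 - ρ)` (`exists_le_norm_kernelFun`).
The integral over this arc alone is at least a constant times `(1 - ρ) h(ρ)`. If `ν ∈ 𝒟̌`, then `ν̂(t)` is at
most a constant times the mass of `[t, 1 - (1 - t)/K)`, and `1 - t` is comparable to `1 - |z| s` for `s` in
this interval and `t ≤ |z|`; Tonelli's theorem bounds `∫_0^{|z|} ν̂ h` by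
`∫ (1 - |z|s) h(|z|s) ν(s) s ds`, up to constants (`exists_lintegral_Ioc_le`).
-/

noncomputable section

namespace RadialBergman

/-! ### Sequences with the difference bounds of a symbol -/

/-- `SymbolBound k s f` says that the differences of `f` up to order `k` are bounded like those of a
symbol of size `s`: the `j`-th difference of `f` is `O(s n / (n + 1) ^ j)` for all `j ≤ k`, uniformly
in `n` (hence the filter `⊤`). -/
def SymbolBound : ℕ → (ℕ → ℝ) → (ℕ → ℝ) → Prop
  | 0, s, f => f =O[⊤] s
  | k + 1, s, f => f =O[⊤] s ∧
      SymbolBound k (fun n => s n / ((n : ℝ) + 1)) (fun n => f (n + 1) - f n)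

namespace SymbolBound

variable {k : ℕ} {s t f g : ℕ → ℝ}

lemma isBigO_div_of_isBigO (h : s =O[⊤] t) :
    (fun n : ℕ => s n / ((n : ℝ) + 1)) =O[⊤] fun n : ℕ => t n / ((n : ℝ) + 1) := by
  simpa only [div_eq_mul_inv] using h.mul (Asymptotics.isBigO_refl (fun n : ℕ => ((n : ℝ) + 1)⁻¹) ⊤)

lemma mono_weight (hst : s =O[⊤] t) (h : SymbolBound k s f) : SymbolBound k t f := by
  induction k generalizing s t f with
  | zero => exact h.trans hst
  | succ k ih => exact ⟨h.1.trans hst, ih (isBigO_div_of_isBigO hst) h.2⟩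

lemma of_succ (h : SymbolBound (k + 1) s f) : SymbolBound k s f := by
  induction k generalizing s f with
  | zero => exact h.1
  | succ k ih => exact ⟨h.1, ih h.2⟩

lemma isBigO_div_self : (fun n : ℕ => s n / ((n : ℝ) + 1)) =O[⊤] s := by
  refine Asymptotics.IsBigO.of_bound 1 (Eventually.of_forall fun n => ?_)
  rw [norm_div, one_mul]
  refine div_le_self (norm_nonneg _) ?_
  rw [Real.norm_of_nonneg (by positivity)]
  linarith [n.cast_nonneg (α := ℝ)]

lemma add (hf : SymbolBound k s f) (hg : SymbolBound k s g) :
    SymbolBound k s (fun n => f n + g n) := by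
  induction k generalizing s f g with
  | zero => exact Asymptotics.IsBigO.add hf hg
  | succ k ih =>
    refine ⟨hf.1.add hg.1, ?_⟩
    convert ih hf.2 hg.2 using 2
    ring

lemma neg (hf : SymbolBound k s f) : SymbolBound k s (fun n => -f n) := by
  induction k generalizing s f with
  | zero => exact Asymptotics.IsBigO.neg_left hf
  | succ k ih =>
    refine ⟨hf.1.neg_left, ?_⟩
    convert ih hf.2 using 2
    ring

lemma shift (hs : (fun n => s (n + 1)) =O[⊤] s) (hf : SymbolBound k s f) :
    SymbolBound k s (fun n => f (n + 1)) := by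
  induction k generalizing s f with
  | zero => exact (Asymptotics.IsBigO.comp_tendsto hf tendsto_top).trans hs
  | succ k ih =>
    refine ⟨(hf.1.comp_tendsto tendsto_top).trans hs, ih ?_ hf.2⟩
    refine Asymptotics.IsBigO.trans ?_ (isBigO_div_of_isBigO hs)
    refine Asymptotics.IsBigO.of_bound 1 (Eventually.of_forall fun n => ?_)
    rw [norm_div, norm_div, one_mul]
    push_cast
    rw [Real.norm_of_nonneg (by positivity : (0 : ℝ) ≤ (n : ℝ) + 1),
      Real.norm_of_nonneg (by positivity : (0 : ℝ) ≤ (n : ℝ) + 1 + 1)]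
    gcongr
    linarith

/-- The product rule: `Δ(fg) = Δf · g + f · Δg + Δf · Δg`. -/
lemma mul (hf : SymbolBound k s f) (hg : SymbolBound k t g) :
    SymbolBound k (fun n => s n * t n) (fun n => f n * g n) := by
  induction k generalizing s t f g with
  | zero => exact Asymptotics.IsBigO.mul hf hg
  | succ k ih =>
    refine ⟨hf.1.mul hg.1, ?_⟩
    have h1 := ih hf.2 hg.of_succ
    have h2 := ih hf.of_succ hg.2
    have h3 := ih hf.2 hg.2
    have e1 : (fun n : ℕ => s n / ((n : ℝ) + 1) * t n) = fun n : ℕ => s n * t n / ((n : ℝ) + 1) := by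
      funext n; ring
    have e2 : (fun n : ℕ => s n * (t n / ((n : ℝ) + 1))) =
        fun n : ℕ => s n * t n / ((n : ℝ) + 1) := by
      funext n; ring
    have e3 : (fun n : ℕ => s n / ((n : ℝ) + 1) * (t n / ((n : ℝ) + 1))) =O[⊤]
        fun n : ℕ => s n * t n / ((n : ℝ) + 1) := by
      rw [← e1]
      exact (Asymptotics.isBigO_refl _ _).mul isBigO_div_self
    rw [e1] at h1
    rw [e2] at h2
    convert (h1.add h2).add (h3.mono_weight e3) using 2
    ring

/-- A positive sequence that is a symbol of its own size has a reciprocal of the same kind. -/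
lemma inv {m : ℕ → ℝ} (hm : ∀ n, 0 < m n) (hms : m =O[⊤] fun n => m (n + 1))
    (h : SymbolBound k m m) : SymbolBound k (fun n => (m n)⁻¹) (fun n => (m n)⁻¹) := by
  have hs : (fun n => (m (n + 1))⁻¹) =O[⊤] fun n => (m n)⁻¹ :=
    hms.inv_rev (Eventually.of_forall fun n h0 => absurd h0 (hm n).ne')
  induction k with
  | zero => exact Asymptotics.isBigO_refl _ _
  | succ k ih =>
    have ha := ih h.of_succ
    refine ⟨Asymptotics.isBigO_refl _ _, ?_⟩
    convert ((h.2.neg.mul ha).mul (ha.shift hs)) using 2 with n n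
    · have := (hm n).ne'
      field_simp
    · have := (hm n).ne'
      have := (hm (n + 1)).ne'
      field_simp
      ring

end SymbolBound

/-- The growth exponent of a positive sequence whose first difference is `O(a n / (n + 1))`. -/
lemma exists_antitone_div_pow {a : ℕ → ℝ} (ha : ∀ n, 0 < a n) (h : SymbolBound 1 a a) :
    ∃ q : ℕ, Antitone fun n : ℕ => a n / ((n : ℝ) + 1) ^ q := by
  obtain ⟨C, hC⟩ := h.2.bound
  obtain ⟨q, hq⟩ := exists_nat_ge C
  refine ⟨q, antitone_nat_of_succ_le fun n => ?_⟩
  have h1 := (eventually_top.1 hC) n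
  have hn : (0 : ℝ) < (n : ℝ) + 1 := by positivity
  rw [Real.norm_eq_abs, Real.norm_of_nonneg (div_nonneg (ha n).le hn.le)] at h1
  have h2 : a (n + 1) ≤ a n * (1 + q * (1 / ((n : ℝ) + 1))) := by
    have : C * (a n / ((n : ℝ) + 1)) ≤ q * (a n / ((n : ℝ) + 1)) := by
      have := (ha n).le
      gcongr
    have h3 := (abs_le.1 h1).2
    calc a (n + 1) ≤ a n + q * (a n / ((n : ℝ) + 1)) := by linarith
      _ = _ := by ring
  have hb := one_add_mul_le_pow (a := 1 / ((n : ℝ) + 1))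
    (by have : (0 : ℝ) < 1 / ((n : ℝ) + 1) := by positivity
        linarith) q
  have h4 : a (n + 1) ≤ a n * (1 + 1 / ((n : ℝ) + 1)) ^ q :=
    h2.trans (mul_le_mul_of_nonneg_left hb (ha n).le)
  push_cast
  rw [div_le_div_iff₀ (by positivity) (by positivity)]
  calc a (n + 1) * ((n : ℝ) + 1) ^ q ≤ a n * (1 + 1 / ((n : ℝ) + 1)) ^ q * ((n : ℝ) + 1) ^ q := by
        gcongr
    _ = a n * ((n : ℝ) + 1 + 1) ^ q := by
        rw [mul_assoc, ← mul_pow]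
        congr 2
        field_simp

/-! ### Tails and moments of a radial weight -/

/-- The measure `ω(r) dr` on `[0, 1)`, as a measure on the real line. -/
def profileMeasure (ω : ℝ → ℝ) : Measure ℝ :=
  (volume.restrict (Ico 0 1)).withDensity fun r => ENNReal.ofReal (ω r)

/-- The moment `∫_0^1 r^n ω(r) dr`. -/
def moment (ω : ℝ → ℝ) (n : ℕ) : ℝ := ∫ r, r ^ n ∂(profileMeasure ω)

namespace IsRadialWeight

variable {ω : ℝ → ℝ}

lemma ae_profileMeasure : ∀ᵐ r ∂(profileMeasure ω), r ∈ Ico (0 : ℝ) 1 :=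
  (withDensity_absolutelyContinuous _ _).ae_le (ae_restrict_mem measurableSet_Ico)

lemma profileMeasure_apply (h : IsRadialWeight ω) {A : Set ℝ} (hA : MeasurableSet A) :
    profileMeasure ω A = ENNReal.ofReal (∫ r in A ∩ Ico 0 1, ω r) := by
  rw [profileMeasure, withDensity_apply _ hA, Measure.restrict_restrict hA,
    ofReal_integral_eq_lintegral_ofReal (h.integrableOn.mono_set inter_subset_right)]
  refine (ae_restrict_iff' (hA.inter measurableSet_Ico)).2 (Eventually.of_forall fun r hr => ?_)
  exact h.nonneg r hr.2

lemma isFiniteMeasure (h : IsRadialWeight ω) : IsFiniteMeasure (profileMeasure ω) :=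
  ⟨by rw [h.profileMeasure_apply .univ]; exact ENNReal.ofReal_lt_top⟩

lemma tail_eq_setIntegral {r : ℝ} (hr : r ∈ Icc (0 : ℝ) 1) :
    tail ω r = ∫ s in Ico r 1, ω s := by
  rw [tail, intervalIntegral.integral_of_le hr.2, integral_Ioc_eq_integral_Ioo,
    ← integral_Ico_eq_integral_Ioo]

lemma profileMeasure_Ici (h : IsRadialWeight ω) {r : ℝ} (hr : r ∈ Icc (0 : ℝ) 1) :
    profileMeasure ω (Ici r) = ENNReal.ofReal (tail ω r) := by
  rw [h.profileMeasure_apply measurableSet_Ici, tail_eq_setIntegral hr]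
  congr 3
  ext s
  simp only [mem_inter_iff, mem_Ici, mem_Ico]
  constructor
  · rintro ⟨a, b, c⟩; exact ⟨a, c⟩
  · rintro ⟨a, b⟩; exact ⟨a, hr.1.trans a, b⟩

lemma tail_nonneg (h : IsRadialWeight ω) {r : ℝ} (hr : r ∈ Icc (0 : ℝ) 1) : 0 ≤ tail ω r := by
  rw [tail_eq_setIntegral hr]
  exact setIntegral_nonneg measurableSet_Ico fun s hs => h.nonneg s ⟨hr.1.trans hs.1, hs.2⟩

lemma tail_eq_measureReal (h : IsRadialWeight ω) {r : ℝ} (hr : r ∈ Icc (0 : ℝ) 1) :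
    tail ω r = (profileMeasure ω).real (Ici r) := by
  rw [Measure.real, h.profileMeasure_Ici hr, ENNReal.toReal_ofReal (h.tail_nonneg hr)]

lemma tail_antitoneOn (h : IsRadialWeight ω) : AntitoneOn (tail ω) (Icc 0 1) := by
  intro r hr s hs hrs
  have := h.isFiniteMeasure
  rw [h.tail_eq_measureReal hr, h.tail_eq_measureReal hs]
  exact measureReal_mono (Ici_subset_Ici.2 hrs)

lemma integrable_pow (h : IsRadialWeight ω) (n : ℕ) :
    Integrable (fun r : ℝ => r ^ n) (profileMeasure ω) := by
  have := h.isFiniteMeasure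
  refine Integrable.of_bound (by fun_prop) 1 ?_
  filter_upwards [ae_profileMeasure] with r hr
  rw [Real.norm_of_nonneg (pow_nonneg hr.1 n)]
  exact pow_le_one₀ hr.1 hr.2.le

lemma moment_antitone (h : IsRadialWeight ω) : Antitone (moment ω) := by
  intro m n hmn
  refine integral_mono_ae (h.integrable_pow n) (h.integrable_pow m) ?_
  filter_upwards [ae_profileMeasure] with r hr
  exact pow_le_pow_of_le_one hr.1 hr.2.le hmn

lemma pow_mul_tail_le_moment (h : IsRadialWeight ω) {r : ℝ} (hr : r ∈ Ico (0 : ℝ) 1) (n : ℕ) :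
    r ^ n * tail ω r ≤ moment ω n := by
  have := h.isFiniteMeasure
  rw [h.tail_eq_measureReal ⟨hr.1, hr.2.le⟩, mul_comm, ← smul_eq_mul, ← setIntegral_const]
  rw [← integral_indicator measurableSet_Ici]
  refine integral_mono_ae ((integrable_const _).indicator measurableSet_Ici) (h.integrable_pow n) ?_
  filter_upwards [ae_profileMeasure] with s hs
  by_cases hrs : s ∈ Ici r
  · rw [indicator_of_mem hrs]
    exact pow_le_pow_left₀ hr.1 hrs n
  · rw [indicator_of_notMem hrs]
    exact pow_nonneg hs.1 n

lemma moment_pos (h : IsRadialWeight ω) (n : ℕ) : 0 < moment ω n := by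
  have h2 : (1 / 2 : ℝ) ∈ Ico (0 : ℝ) 1 := by constructor <;> norm_num
  have := h.tail_pos _ h2
  exact lt_of_lt_of_le (by positivity) (h.pow_mul_tail_le_moment h2 n)

/-- Splitting a moment at `r`: beyond `r` it is at most the tail, and before `r` the factor
`s ^ j ≤ r ^ j` is small. -/
lemma moment_add_le (h : IsRadialWeight ω) {r : ℝ} (hr : r ∈ Icc (0 : ℝ) 1) (n j : ℕ) :
    moment ω (n + j) ≤ r ^ j * moment ω n + tail ω r := by
  have := h.isFiniteMeasure
  have e : tail ω r = ∫ s, (Ici r).indicator (fun _ => (1 : ℝ)) s ∂(profileMeasure ω) := by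
    rw [integral_indicator measurableSet_Ici, setIntegral_const, smul_eq_mul, mul_one,
      h.tail_eq_measureReal hr]
  have hi : Integrable ((Ici r).indicator (fun _ => (1 : ℝ))) (profileMeasure ω) :=
    (integrable_const _).indicator measurableSet_Ici
  rw [e, moment, moment, ← integral_const_mul,
    ← integral_add ((h.integrable_pow n).const_mul _) hi]
  refine integral_mono_ae (h.integrable_pow _) (((h.integrable_pow n).const_mul _).add hi) ?_
  filter_upwards [ae_profileMeasure] with s hs
  have hsn := pow_nonneg hs.1 n
  have hrj := pow_nonneg hr.1 j
  by_cases hrs : s ∈ Ici r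
  · simp only [indicator_of_mem hrs]
    have : s ^ (n + j) ≤ 1 := pow_le_one₀ hs.1 hs.2.le
    nlinarith [mul_nonneg hrj hsn]
  · simp only [indicator_of_notMem hrs, add_zero]
    rw [pow_add, mul_comm]
    have : s ^ j ≤ r ^ j := pow_le_pow_left₀ hs.1 (not_le.1 hrs).le j
    gcongr

end IsRadialWeight

namespace UpperDoubling

variable {ω : ℝ → ℝ}

/-- The doubling condition near `1` propagates to all of `[0, 1)`. -/
lemma exists_tail_le (hω : ω ∈ UpperDoubling) :
    ∃ C : ℝ, 1 ≤ C ∧ ∀ r ∈ Ico (0 : ℝ) 1, tail ω r ≤ C * tail ω ((1 + r) / 2) := by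
  obtain ⟨h, C, hC, hev⟩ := hω
  obtain ⟨r₀, hr₀, hsub⟩ := (mem_nhdsLT_iff_exists_Ioo_subset' (zero_lt_one' ℝ)).1 hev
  set r₁ := max r₀ 0 with hr₁
  have hr₁0 : 0 ≤ r₁ := le_max_right _ _
  have hr₁1 : r₁ < 1 := max_lt hr₀ one_pos
  have hm : (1 + r₁) / 2 ∈ Ico (0 : ℝ) 1 := ⟨by linarith, by linarith⟩
  have hpos := h.tail_pos _ hm
  refine ⟨max 1 (max C (tail ω 0 / tail ω ((1 + r₁) / 2))), le_max_left _ _, fun r hr => ?_⟩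
  have hr' : (1 + r) / 2 ∈ Ico (0 : ℝ) 1 := ⟨by linarith [hr.1], by linarith [hr.2]⟩
  have hp := h.tail_pos _ hr'
  rcases lt_or_ge r₁ r with hlt | hge
  · have : tail ω r ≤ C * tail ω ((1 + r) / 2) := hsub ⟨(le_max_left _ _).trans_lt hlt, hr.2⟩
    refine this.trans ?_
    gcongr
    exact (le_max_left _ _).trans (le_max_right _ _)
  · have h1 : tail ω r ≤ tail ω 0 :=
      h.tail_antitoneOn ⟨le_rfl, zero_le_one⟩ ⟨hr.1, hr.2.le⟩ hr.1
    have h2 : tail ω ((1 + r₁) / 2) ≤ tail ω ((1 + r) / 2) :=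
      h.tail_antitoneOn ⟨hr'.1, hr'.2.le⟩ ⟨hm.1, hm.2.le⟩ (by linarith)
    have h0 : 0 ≤ tail ω 0 := h.tail_nonneg ⟨le_rfl, zero_le_one⟩
    calc tail ω r ≤ tail ω 0 / tail ω ((1 + r₁) / 2) * tail ω ((1 + r₁) / 2) := by
          rw [div_mul_cancel₀ _ hpos.ne']; exact h1
      _ ≤ tail ω 0 / tail ω ((1 + r₁) / 2) * tail ω ((1 + r) / 2) := by gcongr
      _ ≤ _ := by
          gcongr
          exact (le_max_right _ _).trans (le_max_right _ _)

/-- Moments inherit the doubling property: by the layer cake formula it suffices to compare the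
measures of `{t ≤ r ^ n}` and `{t ≤ r ^ (2 n)}`, which are intervals `[u, 1)` and `[√u, 1)`, and
`√u ≤ (1 + u) / 2`. -/
lemma exists_moment_le_two_mul (hω : ω ∈ UpperDoubling) :
    ∃ C : ℝ, 1 ≤ C ∧ ∀ n : ℕ, n ≠ 0 → moment ω n ≤ C * moment ω (2 * n) := by
  obtain ⟨C, hC, hT⟩ := exists_tail_le hω
  have h := hω.1
  have hfin := h.isFiniteMeasure
  refine ⟨C, hC, fun n hn => ?_⟩
  have key : ∀ t ∈ Ioi (0 : ℝ), profileMeasure ω {r | t ≤ r ^ n} ≤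
      ENNReal.ofReal C * profileMeasure ω {r | t ≤ r ^ (2 * n)} := by
    intro t ht
    have ht0 : (0 : ℝ) < t := ht
    obtain ⟨u, hu0, rfl⟩ : ∃ u : ℝ, 0 < u ∧ u ^ n = t :=
      ⟨t ^ ((n : ℝ)⁻¹), Real.rpow_pos_of_pos ht0 _, Real.rpow_inv_natCast_pow ht0.le hn⟩
    have hset : ∀ v : ℝ, 0 ≤ v →
        profileMeasure ω {r | v ^ n ≤ r ^ n} = profileMeasure ω (Ici v) := by
      intro v hv
      refine measure_congr ?_
      filter_upwards [IsRadialWeight.ae_profileMeasure] with r hr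
      exact propext (pow_le_pow_iff_left₀ hv hr.1 hn)
    have hset2 : profileMeasure ω {r | u ^ n ≤ r ^ (2 * n)} = profileMeasure ω (Ici (√u)) := by
      refine measure_congr ?_
      filter_upwards [IsRadialWeight.ae_profileMeasure] with r hr
      refine propext ?_
      change u ^ n ≤ r ^ (2 * n) ↔ √u ≤ r
      rw [pow_mul, pow_le_pow_iff_left₀ hu0.le (sq_nonneg r) hn, Real.sqrt_le_left hr.1]
    rw [hset u hu0.le, hset2]
    rcases lt_or_ge u 1 with hu1 | hu1
    · have hs1 : √u ≤ (1 + u) / 2 := by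
        have := Real.sq_sqrt hu0.le
        nlinarith [sq_nonneg (√u - 1)]
      calc profileMeasure ω (Ici u) = ENNReal.ofReal (tail ω u) :=
            h.profileMeasure_Ici ⟨hu0.le, hu1.le⟩
        _ ≤ ENNReal.ofReal (C * tail ω ((1 + u) / 2)) :=
            ENNReal.ofReal_le_ofReal (hT u ⟨hu0.le, hu1⟩)
        _ = ENNReal.ofReal C * profileMeasure ω (Ici ((1 + u) / 2)) := by
            rw [ENNReal.ofReal_mul (by linarith),
              h.profileMeasure_Ici ⟨by linarith, by linarith⟩]
        _ ≤ _ := by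
            gcongr
    · have : profileMeasure ω (Ici u) = 0 := by
        refine measure_mono_null (fun r hr => ?_) (ae_iff.1 IsRadialWeight.ae_profileMeasure)
        exact fun hr' => absurd hr'.2 (not_lt.2 (hu1.trans hr))
      rw [this]
      exact bot_le
  have hnn : ∀ m : ℕ, 0 ≤ᵐ[profileMeasure ω] fun r : ℝ => r ^ m := fun m => by
    filter_upwards [IsRadialWeight.ae_profileMeasure] with r hr
    exact pow_nonneg hr.1 m
  have hle : ∫⁻ r, ENNReal.ofReal (r ^ n) ∂(profileMeasure ω) ≤
      ENNReal.ofReal C * ∫⁻ r, ENNReal.ofReal (r ^ (2 * n)) ∂(profileMeasure ω) := by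
    rw [lintegral_eq_lintegral_meas_le _ (hnn n) (by fun_prop),
      lintegral_eq_lintegral_meas_le _ (hnn (2 * n)) (by fun_prop),
      ← lintegral_const_mul' _ _ ENNReal.ofReal_ne_top]
    exact setLIntegral_mono' measurableSet_Ioi key
  rw [← ofReal_integral_eq_lintegral_ofReal (h.integrable_pow n) (hnn n),
    ← ofReal_integral_eq_lintegral_ofReal (h.integrable_pow _) (hnn _),
    ← ENNReal.ofReal_mul (by linarith)] at hle
  refine (ENNReal.ofReal_le_ofReal_iff ?_).1 hle
  have := (h.moment_pos (2 * n)).le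
  exact mul_nonneg (by linarith) this

/-- Doubling of moments in the form that also covers the zeroth moment. -/
lemma exists_moment_le (hω : ω ∈ UpperDoubling) :
    ∃ C : ℝ, 1 ≤ C ∧ ∀ n : ℕ, moment ω n ≤ C * moment ω (2 * n + 1) := by
  obtain ⟨C, hC, h2⟩ := exists_moment_le_two_mul hω
  have h := hω.1
  have h1 := h.moment_pos 1
  refine ⟨max (C * C) (moment ω 0 / moment ω 1), le_max_of_le_left (by nlinarith), fun n => ?_⟩
  rcases eq_or_ne n 0 with rfl | hn
  · calc moment ω 0 = moment ω 0 / moment ω 1 * moment ω 1 := by rw [div_mul_cancel₀ _ h1.ne']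
      _ ≤ _ := by
        gcongr
        exact le_max_right _ _
  · have hp := h.moment_pos (2 * n + 1)
    calc moment ω n ≤ C * moment ω (2 * n) := h2 n hn
      _ ≤ C * (C * moment ω (2 * (2 * n))) := by
          gcongr
          exact h2 _ (by omega)
      _ ≤ C * (C * moment ω (2 * n + 1)) := by
          gcongr
          exact h.moment_antitone (by omega)
      _ = C * C * moment ω (2 * n + 1) := by ring
      _ ≤ _ := by
          gcongr
          exact le_max_left _ _

end UpperDoubling

/-! ### The coefficients of the kernel -/

/-- The `n`-th coefficient `1 / (2 ∫_0^1 r^(2n+1) ω(r) dr)` of the kernel `B^ω_z(ζ)` as a power series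
in `z̄ ζ`. -/
def kernelCoeff (ω : ℝ → ℝ) (n : ℕ) : ℝ := (2 * moment ω (2 * n + 1))⁻¹

section

variable {ω : ℝ → ℝ}

lemma IsRadialWeight.kernelCoeff_pos (h : IsRadialWeight ω) (n : ℕ) : 0 < kernelCoeff ω n := by
  have := h.moment_pos (2 * n + 1)
  rw [kernelCoeff]; positivity

lemma IsRadialWeight.kernelCoeff_monotone (h : IsRadialWeight ω) : Monotone (kernelCoeff ω) := by
  intro m n hmn
  have := h.moment_pos (2 * n + 1)
  rw [kernelCoeff, kernelCoeff]
  gcongr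
  exact h.moment_antitone (by omega)

/-- With `x = (n + 1) (1 - r)`, this is `x ^ j exp (-x) ≤ j!`. -/
lemma pow_mul_one_sub_pow_le {r : ℝ} (hr : r ∈ Ico (0 : ℝ) 1) (n j : ℕ) :
    r ^ (n + 1) * (1 - r ^ 2) ^ j ≤ 2 ^ j * j.factorial / ((n : ℝ) + 1) ^ j := by
  set x : ℝ := ((n : ℝ) + 1) * (1 - r) with hx
  have h1r : 0 ≤ 1 - r := by linarith [hr.2]
  have hx0 : 0 ≤ x := by positivity
  have h1 : x ^ j ≤ j.factorial * Real.exp x := by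
    have := Real.pow_div_factorial_le_exp x hx0 j
    rwa [div_le_iff₀ (by positivity), mul_comm] at this
  have h2 : r ^ (n + 1) ≤ Real.exp (-x) := by
    calc r ^ (n + 1) ≤ Real.exp (r - 1) ^ (n + 1) :=
          pow_le_pow_left₀ hr.1 (by linarith [Real.add_one_le_exp (r - 1)]) _
      _ = Real.exp (-x) := by
          rw [← Real.exp_nat_mul]
          congr 1
          rw [hx]; push_cast; ring
  have h3 : (1 - r ^ 2) ^ j ≤ 2 ^ j * (1 - r) ^ j := by
    rw [← mul_pow]
    have := hr.1
    exact pow_le_pow_left₀ (by nlinarith) (by nlinarith) j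
  rw [le_div_iff₀ (by positivity)]
  have hrn : 0 ≤ r ^ (n + 1) := pow_nonneg hr.1 _
  calc r ^ (n + 1) * (1 - r ^ 2) ^ j * ((n : ℝ) + 1) ^ j
      ≤ r ^ (n + 1) * (2 ^ j * (1 - r) ^ j) * ((n : ℝ) + 1) ^ j := by gcongr
    _ = 2 ^ j * (r ^ (n + 1) * x ^ j) := by rw [hx, mul_pow]; ring
    _ ≤ 2 ^ j * (Real.exp (-x) * (j.factorial * Real.exp x)) := by gcongr
    _ = 2 ^ j * j.factorial := by
        rw [Real.exp_neg]
        field_simp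

namespace UpperDoubling

/-- The `j`-th difference of the odd moments is their integral against `(r² - 1) ^ j`; near the point
where `r ^ n` lives this factor is of size `n⁻ʲ`. -/
lemma isBigO_integral_pow_mul (hω : ω ∈ UpperDoubling) (j : ℕ) :
    (fun n : ℕ => ∫ r, r ^ (2 * n + 1) * (r ^ 2 - 1) ^ j ∂(profileMeasure ω)) =O[⊤]
      fun n : ℕ => moment ω (2 * n + 1) / ((n : ℝ) + 1) ^ j := by
  obtain ⟨C, hC, hm⟩ := exists_moment_le hω
  have h := hω.1
  refine Asymptotics.IsBigO.of_bound (2 ^ j * j.factorial * C) (Eventually.of_forall fun n => ?_)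
  rw [Real.norm_of_nonneg (div_nonneg (h.moment_pos _).le (by positivity))]
  have hb : ∀ᵐ r ∂(profileMeasure ω), ‖r ^ (2 * n + 1) * (r ^ 2 - 1) ^ j‖ ≤
      2 ^ j * j.factorial / ((n : ℝ) + 1) ^ j * r ^ n := by
    filter_upwards [IsRadialWeight.ae_profileMeasure] with r hr
    have e : |r ^ 2 - 1| = 1 - r ^ 2 := by
      rw [abs_of_nonpos (by nlinarith [hr.1, hr.2]), neg_sub]
    rw [norm_mul, norm_pow, norm_pow, Real.norm_eq_abs, Real.norm_eq_abs, e, abs_of_nonneg hr.1]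
    calc r ^ (2 * n + 1) * (1 - r ^ 2) ^ j = r ^ (n + 1) * (1 - r ^ 2) ^ j * r ^ n := by ring
      _ ≤ _ := mul_le_mul_of_nonneg_right (pow_mul_one_sub_pow_le hr n j) (pow_nonneg hr.1 n)
  refine (norm_integral_le_of_norm_le ((h.integrable_pow n).const_mul _) hb).trans ?_
  rw [integral_const_mul]
  calc 2 ^ j * j.factorial / ((n : ℝ) + 1) ^ j * moment ω n
      ≤ 2 ^ j * j.factorial / ((n : ℝ) + 1) ^ j * (C * moment ω (2 * n + 1)) := by
        gcongr
        exact hm n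
    _ = _ := by ring

lemma symbolBound_moment (hω : ω ∈ UpperDoubling) (k : ℕ) :
    SymbolBound k (fun n => moment ω (2 * n + 1)) (fun n => moment ω (2 * n + 1)) := by
  have h := hω.1
  have := h.isFiniteMeasure
  suffices H : ∀ j, SymbolBound k (fun n : ℕ => moment ω (2 * n + 1) / ((n : ℝ) + 1) ^ j)
      (fun n => ∫ r, r ^ (2 * n + 1) * (r ^ 2 - 1) ^ j ∂(profileMeasure ω)) by
    simpa [moment] using H 0
  induction k with
  | zero => exact fun j => isBigO_integral_pow_mul hω j
  | succ k ih =>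
    intro j
    refine ⟨isBigO_integral_pow_mul hω j, ?_⟩
    have hint : ∀ n i : ℕ, Integrable (fun r : ℝ => r ^ n * (r ^ 2 - 1) ^ i) (profileMeasure ω) := by
      intro n i
      refine Integrable.of_bound (by fun_prop) 1 ?_
      filter_upwards [IsRadialWeight.ae_profileMeasure] with r hr
      have e : |r ^ 2 - 1| = 1 - r ^ 2 := by
        rw [abs_of_nonpos (by nlinarith [hr.1, hr.2]), neg_sub]
      rw [norm_mul, norm_pow, norm_pow, Real.norm_eq_abs, Real.norm_eq_abs, e, abs_of_nonneg hr.1]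
      exact mul_le_one₀ (pow_le_one₀ hr.1 hr.2.le)
        (pow_nonneg (by nlinarith [hr.1, hr.2]) _)
        (pow_le_one₀ (by nlinarith [hr.1, hr.2]) (by nlinarith [hr.1, hr.2]))
    convert ih (j + 1) using 2 with n n
    · rw [pow_succ, div_div]
    · rw [← integral_sub (hint _ _) (hint _ _)]
      congr 1
      funext r
      ring

lemma symbolBound_kernelCoeff (hω : ω ∈ UpperDoubling) (k : ℕ) :
    SymbolBound k (kernelCoeff ω) (kernelCoeff ω) := by
  have h := hω.1
  obtain ⟨C, hC, hm⟩ := exists_moment_le hω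
  have hO : (fun n => moment ω (2 * n + 1)) =O[⊤] fun n => moment ω (2 * (n + 1) + 1) := by
    refine Asymptotics.IsBigO.of_bound C (Eventually.of_forall fun n => ?_)
    rw [Real.norm_of_nonneg (h.moment_pos _).le, Real.norm_of_nonneg (h.moment_pos _).le]
    refine (hm _).trans ?_
    gcongr
    exact h.moment_antitone (by omega)
  have h1 := SymbolBound.inv (fun n => h.moment_pos (2 * n + 1)) hO (symbolBound_moment hω k)
  have hc : SymbolBound k (fun _ : ℕ => (1 : ℝ)) (fun _ => (2 : ℝ)⁻¹) := by
    have hz : ∀ (l : ℕ) (s : ℕ → ℝ), SymbolBound l s (fun _ => 0) := by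
      intro l
      induction l with
      | zero => exact fun s => Asymptotics.isBigO_zero _ _
      | succ l ih => exact fun s => ⟨Asymptotics.isBigO_zero _ _, by simpa using ih _⟩
    have hb : (fun _ : ℕ => (2 : ℝ)⁻¹) =O[⊤] fun _ : ℕ => (1 : ℝ) :=
      Asymptotics.isBigO_const_const _ one_ne_zero _
    cases k with
    | zero => exact hb
    | succ k => exact ⟨hb, by simpa using hz k _⟩
  have h2 := hc.mul h1
  have e : kernelCoeff ω = fun n => (2 : ℝ)⁻¹ * (moment ω (2 * n + 1))⁻¹ := by
    funext n; rw [kernelCoeff, mul_inv]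
  rw [e]
  refine SymbolBound.mono_weight ?_ h2
  refine Asymptotics.IsBigO.of_bound 2 (Eventually.of_forall fun n => ?_)
  rw [norm_mul, norm_mul, norm_one, Real.norm_of_nonneg (by norm_num : (0 : ℝ) ≤ 2⁻¹)]
  exact le_of_eq (by ring)

/-- The kernel coefficients have polynomial growth. -/
lemma exists_kernelCoeff_antitone (hω : ω ∈ UpperDoubling) :
    ∃ q : ℕ, Antitone fun n : ℕ => kernelCoeff ω n / ((n : ℝ) + 1) ^ q :=
  exists_antitone_div_pow hω.1.kernelCoeff_pos (symbolBound_kernelCoeff hω 1)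

end UpperDoubling

/-! ### The tail as a function of the distance to the boundary -/

/-- The tail of `ω` at distance `x` from the boundary, extended by its value at `x = 1` to all larger
distances. -/
def tailAt (ω : ℝ → ℝ) (x : ℝ) : ℝ := tail ω (1 - min x 1)

lemma tailAt_of_le {x : ℝ} (hx : x ≤ 1) : tailAt ω x = tail ω (1 - x) := by
  rw [tailAt, min_eq_left hx]

lemma IsRadialWeight.tailAt_pos (h : IsRadialWeight ω) {x : ℝ} (hx : 0 < x) : 0 < tailAt ω x := by
  have : 0 < min x 1 := lt_min hx one_pos
  exact h.tail_pos _ ⟨by linarith [min_le_right x 1], by linarith⟩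

lemma IsRadialWeight.tailAt_mono (h : IsRadialWeight ω) {x y : ℝ} (hx : 0 < x) (hxy : x ≤ y) :
    tailAt ω x ≤ tailAt ω y := by
  have h1 : 0 < min x 1 := lt_min hx one_pos
  have h2 : min x 1 ≤ min y 1 := min_le_min_right 1 hxy
  exact h.tail_antitoneOn ⟨by linarith [min_le_right y 1], by linarith⟩
    ⟨by linarith [min_le_right x 1], by linarith⟩ (by linarith)

namespace UpperDoubling

lemma exists_tailAt_two_mul_le (hω : ω ∈ UpperDoubling) :
    ∃ C : ℝ, 1 ≤ C ∧ ∀ x : ℝ, 0 < x → tailAt ω (2 * x) ≤ C * tailAt ω x := by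
  obtain ⟨C, hC, hT⟩ := exists_tail_le hω
  have h := hω.1
  refine ⟨C, hC, fun x hx => ?_⟩
  have h0 : 0 < min (2 * x) 1 := lt_min (by linarith) one_pos
  have h1 := hT (1 - min (2 * x) 1) ⟨by linarith [min_le_right (2 * x) 1], by linarith⟩
  have e : (1 + (1 - min (2 * x) 1)) / 2 = 1 - min (min (2 * x) 1 / 2) 1 := by
    rw [min_eq_left (a := min (2 * x) 1 / 2) (by linarith [min_le_right (2 * x) 1])]; ring
  rw [e] at h1
  refine (show tailAt ω (2 * x) ≤ C * tailAt ω (min (2 * x) 1 / 2) from h1).trans ?_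
  gcongr
  exact h.tailAt_mono (by linarith) (by linarith [min_le_left (2 * x) 1])

lemma exists_tailAt_mul_le (hω : ω ∈ UpperDoubling) (A : ℝ) :
    ∃ C : ℝ, 1 ≤ C ∧ ∀ x y : ℝ, 0 < x → 0 < y → x ≤ A * y → tailAt ω x ≤ C * tailAt ω y := by
  obtain ⟨C, hC, hT⟩ := exists_tailAt_two_mul_le hω
  have h := hω.1
  have hpow : ∀ k : ℕ, ∀ y : ℝ, 0 < y → tailAt ω (2 ^ k * y) ≤ C ^ k * tailAt ω y := by
    intro k
    induction k with
    | zero => intro y _; simp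
    | succ k ih =>
      intro y hy
      calc tailAt ω (2 ^ (k + 1) * y) = tailAt ω (2 * (2 ^ k * y)) := by ring_nf
        _ ≤ C * tailAt ω (2 ^ k * y) := hT _ (by positivity)
        _ ≤ C * (C ^ k * tailAt ω y) := by gcongr; exact ih y hy
        _ = _ := by ring
  obtain ⟨k, hk⟩ := pow_unbounded_of_one_lt A (one_lt_two (α := ℝ))
  refine ⟨C ^ k, one_le_pow₀ hC, fun x y hx hy hxy => (h.tailAt_mono hx (hxy.trans ?_)).trans
    (hpow k y hy)⟩
  gcongr

/-- The coefficient `a_n` is at most a constant times `1 / ω̂(1 - 1 / (n + 1))`. -/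
lemma exists_kernelCoeff_le (hω : ω ∈ UpperDoubling) :
    ∃ C : ℝ, 0 < C ∧ ∀ n : ℕ, kernelCoeff ω n * tailAt ω (1 / ((n : ℝ) + 1)) ≤ C := by
  obtain ⟨C, hC, hT⟩ := exists_tailAt_mul_le hω 2
  have h := hω.1
  refine ⟨2 * C, by linarith, fun n => ?_⟩
  set x : ℝ := 1 / (2 * ((n : ℝ) + 1)) with hx
  have hx0 : 0 < x := by positivity
  have hx1 : x ≤ 1 / 2 := by
    rw [hx]
    apply one_div_le_one_div_of_le (by norm_num)
    linarith [n.cast_nonneg (α := ℝ)]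
  have h1 := hT (1 / ((n : ℝ) + 1)) x (by positivity) hx0 (le_of_eq (by rw [hx]; field_simp))
  have h2 : (1 - x) ^ (2 * n + 1) * tailAt ω x ≤ moment ω (2 * n + 1) := by
    rw [tailAt_of_le (by linarith)]
    exact h.pow_mul_tail_le_moment ⟨by linarith, by linarith⟩ _
  -- Bernoulli gives `(1 - x) ^ (n + 1) ≥ 1 / 2`.
  have h3 : 1 / 4 ≤ (1 - x) ^ (2 * n + 1) := by
    have hb := one_add_mul_le_pow (a := -x) (by linarith) (n + 1)
    have e : (1 : ℝ) + ((n + 1 : ℕ) : ℝ) * -x = 1 / 2 := by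
      rw [hx]; push_cast; field_simp; norm_num
    rw [e, ← sub_eq_add_neg] at hb
    calc (1 / 4 : ℝ) = 1 / 2 * (1 / 2) := by norm_num
      _ ≤ (1 - x) ^ (n + 1) * (1 - x) ^ (n + 1) := by gcongr
      _ = (1 - x) ^ (2 * n + 2) := by rw [← pow_add]; congr 1; ring
      _ ≤ _ := pow_le_pow_of_le_one (by linarith) (by linarith) (by omega)
  have hp := h.tailAt_pos hx0
  have hm := h.moment_pos (2 * n + 1)
  rw [kernelCoeff, inv_mul_le_iff₀ (by positivity)]
  have h4 : 1 / 4 * tailAt ω x ≤ moment ω (2 * n + 1) :=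
    (mul_le_mul_of_nonneg_right h3 hp.le).trans h2
  nlinarith

/-- The coefficient `a_n` is at least a constant times `1 / ω̂(1 - 1 / (n + 1))`. The moment is split at
`r = 1 - 1 / (n + 1)`: passing from `n + 1` to `K (n + 1)` costs a factor `K ^ q`, while the part of the
larger moment before `r` gains `exp (-2 (K - 1))`, which wins for large `K`. -/
lemma exists_le_kernelCoeff (hω : ω ∈ UpperDoubling) :
    ∃ c : ℝ, 0 < c ∧ ∀ n : ℕ, c ≤ kernelCoeff ω n * tailAt ω (1 / ((n : ℝ) + 1)) := by
  obtain ⟨q, hq⟩ := exists_kernelCoeff_antitone hω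
  have h := hω.1
  obtain ⟨K, hK1, hK⟩ : ∃ K : ℕ, 1 ≤ K ∧ (K : ℝ) ^ q * Real.exp (-(2 * ((K : ℝ) - 1))) ≤ 1 / 2 := by
    have h1 := (Real.tendsto_pow_mul_exp_neg_atTop_nhds_zero q).comp tendsto_natCast_atTop_atTop
    have h2 := (h1.eventually (gt_mem_nhds (by norm_num : (0 : ℝ) < 1 / 2))).and (eventually_ge_atTop 2)
    obtain ⟨K, hK, hK2⟩ := h2.exists
    refine ⟨K, by omega, le_trans ?_ hK.le⟩
    simp only [Function.comp_apply]
    have : (2 : ℝ) ≤ K := by exact_mod_cast hK2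
    gcongr
    linarith
  have hK0 : (0 : ℝ) < (K : ℝ) ^ q := by positivity
  refine ⟨1 / (4 * (K : ℝ) ^ q), by positivity, fun n => ?_⟩
  have hn : (0 : ℝ) < (n : ℝ) + 1 := by positivity
  set x : ℝ := 1 / ((n : ℝ) + 1) with hx
  have hx0 : 0 < x := by positivity
  have hx1 : x ≤ 1 := by
    rw [hx, div_le_one hn]; linarith [n.cast_nonneg (α := ℝ)]
  obtain ⟨d, rfl⟩ : ∃ d, K = d + 1 := ⟨K - 1, by omega⟩
  set l : ℕ := d * (n + 1) with hl
  have hml : moment ω (2 * n + 1) ≤ ((d + 1 : ℕ) : ℝ) ^ q * moment ω (2 * n + 1 + 2 * l) := by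
    have h1 := hq (show n ≤ n + l by omega)
    simp only [kernelCoeff] at h1
    have hm1 := h.moment_pos (2 * n + 1)
    have hm2 := h.moment_pos (2 * (n + l) + 1)
    rw [div_le_div_iff₀ (by positivity) (by positivity), inv_mul_le_iff₀ (by positivity)] at h1
    have e : ((n + l : ℕ) : ℝ) + 1 = ((d + 1 : ℕ) : ℝ) * ((n : ℝ) + 1) := by
      rw [hl]; push_cast; ring
    rw [e, mul_pow] at h1
    have e2 : 2 * (n + l) + 1 = 2 * n + 1 + 2 * l := by ring
    rw [e2] at h1 hm2
    have hnq : (0 : ℝ) < ((n : ℝ) + 1) ^ q := by positivity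
    have h2 : ((n : ℝ) + 1) ^ q * moment ω (2 * n + 1) ≤
        ((n : ℝ) + 1) ^ q * (((d + 1 : ℕ) : ℝ) ^ q * moment ω (2 * n + 1 + 2 * l)) := by
      have h3 : 2 * moment ω (2 * n + 1 + 2 * l) * ((2 * moment ω (2 * n + 1))⁻¹ *
          (((d + 1 : ℕ) : ℝ) ^ q * ((n : ℝ) + 1) ^ q)) * moment ω (2 * n + 1) =
          ((n : ℝ) + 1) ^ q * (((d + 1 : ℕ) : ℝ) ^ q * moment ω (2 * n + 1 + 2 * l)) := by
        field_simp
      rw [← h3]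
      exact mul_le_mul_of_nonneg_right h1 hm1.le
    exact le_of_mul_le_mul_left h2 hnq
  have hsplit := h.moment_add_le (r := 1 - x) ⟨by linarith, by linarith⟩ (2 * n + 1) (2 * l)
  have hexp : (1 - x) ^ (2 * l) ≤ Real.exp (-(2 * (((d + 1 : ℕ) : ℝ) - 1))) := by
    calc (1 - x) ^ (2 * l) ≤ Real.exp (-x) ^ (2 * l) :=
          pow_le_pow_left₀ (by linarith) (by linarith [Real.add_one_le_exp (-x)]) _
      _ = _ := by
          rw [← Real.exp_nat_mul]
          congr 1
          rw [hl, hx]; push_cast; field_simp; ring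
  have hm := h.moment_pos (2 * n + 1)
  have ht : tailAt ω x = tail ω (1 - x) := tailAt_of_le hx1
  have hmain : moment ω (2 * n + 1) ≤ 2 * ((d + 1 : ℕ) : ℝ) ^ q * tailAt ω x := by
    have h5 : ((d + 1 : ℕ) : ℝ) ^ q * ((1 - x) ^ (2 * l) * moment ω (2 * n + 1)) ≤
        1 / 2 * moment ω (2 * n + 1) := by
      rw [← mul_assoc]
      refine mul_le_mul_of_nonneg_right (le_trans ?_ hK) hm.le
      gcongr
    have h6 := hml.trans (mul_le_mul_of_nonneg_left hsplit hK0.le)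
    rw [mul_add, ← ht] at h6
    linarith
  rw [kernelCoeff, inv_mul_eq_div, div_le_div_iff₀ (by positivity) (by positivity)]
  linarith

end UpperDoubling

end

/-! ### Power series with symbol coefficients -/

lemma sum_inv_sq_shift_le (L M : ℕ) :
    ∑ i ∈ Finset.range M, 1 / ((i : ℝ) + L + 1) ^ 2 ≤ 2 / ((L : ℝ) + 1) - 2 / ((M : ℝ) + L + 1) := by
  induction M with
  | zero => simp
  | succ M ih =>
    rw [Finset.sum_range_succ]
    have hm : (1 : ℝ) ≤ (M : ℝ) + L + 1 := by
      have := M.cast_nonneg (α := ℝ)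
      have := L.cast_nonneg (α := ℝ)
      linarith
    push_cast
    set m : ℝ := (M : ℝ) + L + 1 with hmdef
    have e : (M : ℝ) + 1 + L + 1 = m + 1 := by rw [hmdef]; ring
    rw [e]
    have : 1 / m ^ 2 ≤ 2 / m - 2 / (m + 1) := by
      rw [div_sub_div _ _ (by positivity) (by positivity),
        div_le_div_iff₀ (by positivity) (by positivity)]
      nlinarith
    linarith

/-- Tail sums of `a n / (n + 1) ^ (q + 2)` when `a n / (n + 1) ^ q` is antitone. -/
lemma summable_and_tsum_div_pow_le {a : ℕ → ℝ} (ha : ∀ n, 0 ≤ a n) {q : ℕ}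
    (hq : Antitone fun n : ℕ => a n / ((n : ℝ) + 1) ^ q) (L : ℕ) :
    Summable (fun i : ℕ => a (i + L) / (((i + L : ℕ) : ℝ) + 1) ^ (q + 2)) ∧
      ∑' i : ℕ, a (i + L) / (((i + L : ℕ) : ℝ) + 1) ^ (q + 2) ≤
        2 * (a L / ((L : ℝ) + 1) ^ (q + 2) * ((L : ℝ) + 1)) := by
  have hb : ∀ M : ℕ, ∑ i ∈ Finset.range M, a (i + L) / (((i + L : ℕ) : ℝ) + 1) ^ (q + 2) ≤
      2 * (a L / ((L : ℝ) + 1) ^ (q + 2) * ((L : ℝ) + 1)) := by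
    intro M
    calc ∑ i ∈ Finset.range M, a (i + L) / (((i + L : ℕ) : ℝ) + 1) ^ (q + 2)
        ≤ ∑ i ∈ Finset.range M, a L / ((L : ℝ) + 1) ^ q * (1 / ((i : ℝ) + L + 1) ^ 2) := by
          refine Finset.sum_le_sum fun i _ => ?_
          have h1 : a (i + L) / (((i + L : ℕ) : ℝ) + 1) ^ q ≤ a L / ((L : ℝ) + 1) ^ q :=
            hq (show L ≤ i + L by omega)
          rw [pow_add, ← div_div, div_eq_mul_one_div]
          push_cast at h1 ⊢
          gcongr
      _ = a L / ((L : ℝ) + 1) ^ q * ∑ i ∈ Finset.range M, 1 / ((i : ℝ) + L + 1) ^ 2 := by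
          rw [Finset.mul_sum]
      _ ≤ a L / ((L : ℝ) + 1) ^ q * (2 / ((L : ℝ) + 1)) := by
          refine mul_le_mul_of_nonneg_left ((sum_inv_sq_shift_le L M).trans ?_)
            (div_nonneg (ha L) (by positivity))
          rw [sub_le_self_iff]
          positivity
      _ = _ := by
          rw [pow_add]
          field_simp
  have hnn : ∀ i : ℕ, 0 ≤ a (i + L) / (((i + L : ℕ) : ℝ) + 1) ^ (q + 2) := fun i =>
    div_nonneg (ha _) (by positivity)
  exact ⟨summable_of_sum_range_le hnn hb, Real.tsum_le_of_sum_range_le hnn hb⟩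

lemma summable_ofReal_mul_pow {s f : ℕ → ℝ} (hs0 : ∀ n, 0 ≤ s n)
    (hs : ∀ r ∈ Ico (0 : ℝ) 1, Summable fun n => s n * r ^ n) (hf : f =O[⊤] s) {w : ℂ}
    (hw : ‖w‖ < 1) : Summable fun n => (f n : ℂ) * w ^ n := by
  obtain ⟨C, hC⟩ := hf.bound
  refine Summable.of_norm_bounded ((hs ‖w‖ ⟨norm_nonneg w, hw⟩).mul_left C) fun n => ?_
  have := (eventually_top.1 hC) n
  rw [Real.norm_of_nonneg (hs0 n)] at this
  rw [norm_mul, norm_pow, Complex.norm_real, ← mul_assoc]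
  gcongr

/-- Summation by parts, `k` times, of the tail of a power series with symbol coefficients: the part of
the series beyond `L ≈ 1 / |1 - w|` is at most a constant times `s L / |1 - w|`. -/
lemma exists_norm_tsum_tail_le (k : ℕ) {s f : ℕ → ℝ} (hs0 : ∀ n, 0 ≤ s n)
    (hs : ∀ r ∈ Ico (0 : ℝ) 1, Summable fun n => s n * r ^ n) (hf : SymbolBound k s f) {C₀ : ℝ}
    (hsum : ∀ L : ℕ, Summable (fun i : ℕ => s (i + L) / (((i + L : ℕ) : ℝ) + 1) ^ k) ∧
      ∑' i : ℕ, s (i + L) / (((i + L : ℕ) : ℝ) + 1) ^ k ≤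
        C₀ * (s L / ((L : ℝ) + 1) ^ k * ((L : ℝ) + 1))) :
    ∃ C : ℝ, 0 ≤ C ∧ ∀ w : ℂ, ‖w‖ < 1 → ∀ L : ℕ, (L : ℝ) * ‖1 - w‖ ≤ 1 →
      1 ≤ ((L : ℝ) + 1) * ‖1 - w‖ →
      ‖∑' i : ℕ, (f (i + L) : ℂ) * w ^ (i + L)‖ * ‖1 - w‖ ≤ C * s L := by
  induction k generalizing s f with
  | zero =>
    obtain ⟨C, hC0, hC⟩ := Asymptotics.IsBigO.exists_nonneg hf
    have hC := eventually_top.1 hC.bound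
    refine ⟨C * (|C₀| * 3), by positivity, fun w hw L hL _ => ?_⟩
    obtain ⟨h1, h2⟩ := hsum L
    simp only [pow_zero, div_one] at h1 h2
    have hδ : ‖1 - w‖ ≤ 2 := (norm_sub_le _ _).trans (by rw [norm_one]; linarith)
    have h3 : ‖∑' i : ℕ, (f (i + L) : ℂ) * w ^ (i + L)‖ ≤ ∑' i : ℕ, C * s (i + L) := by
      refine tsum_of_norm_bounded (h1.mul_left C).hasSum fun i => ?_
      rw [norm_mul, norm_pow, Complex.norm_real]
      have h4 := hC (i + L)
      rw [Real.norm_of_nonneg (hs0 _)] at h4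
      calc ‖f (i + L)‖ * ‖w‖ ^ (i + L) ≤ ‖f (i + L)‖ * 1 := by
            gcongr
            exact pow_le_one₀ (norm_nonneg w) hw.le
        _ ≤ _ := by rw [mul_one]; exact h4
    rw [tsum_mul_left] at h3
    have h5 : ∑' i : ℕ, s (i + L) ≤ |C₀| * (s L * ((L : ℝ) + 1)) :=
      h2.trans (mul_le_mul_of_nonneg_right (le_abs_self _) (mul_nonneg (hs0 L) (by positivity)))
    have hsL := hs0 L
    calc ‖∑' i : ℕ, (f (i + L) : ℂ) * w ^ (i + L)‖ * ‖1 - w‖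
        ≤ C * (|C₀| * (s L * ((L : ℝ) + 1))) * ‖1 - w‖ := by
          gcongr
          exact h3.trans (by gcongr)
      _ = C * (|C₀| * (L * ‖1 - w‖ + ‖1 - w‖)) * s L := by ring
      _ ≤ C * (|C₀| * 3) * s L := by
          gcongr
          linarith
  | succ k ih =>
    have hs0' : ∀ n : ℕ, 0 ≤ s n / ((n : ℝ) + 1) := fun n => div_nonneg (hs0 n) (by positivity)
    have hdiv : ∀ n : ℕ, s n / ((n : ℝ) + 1) ≤ s n := fun n =>
      div_le_self (hs0 n) (by linarith [n.cast_nonneg (α := ℝ)])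
    have hs' : ∀ r ∈ Ico (0 : ℝ) 1, Summable fun n : ℕ => s n / ((n : ℝ) + 1) * r ^ n := fun r hr =>
      (hs r hr).of_nonneg_of_le (fun n => mul_nonneg (hs0' n) (pow_nonneg hr.1 n))
        fun n => mul_le_mul_of_nonneg_right (hdiv n) (pow_nonneg hr.1 n)
    obtain ⟨C', hC'0, hC'⟩ := ih hs0' hs' hf.2 (by
      intro L
      have e : ∀ n : ℕ, s n / ((n : ℝ) + 1) / ((n : ℝ) + 1) ^ k = s n / ((n : ℝ) + 1) ^ (k + 1) := by
        intro n; rw [div_div, pow_succ']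
      simpa only [e] using hsum L)
    obtain ⟨C, hC0, hC⟩ := Asymptotics.IsBigO.exists_nonneg hf.1
    have hC := eventually_top.1 hC.bound
    refine ⟨C + C', by positivity, fun w hw L hL hL' => ?_⟩
    have hS1 : Summable fun n => (f n : ℂ) * w ^ n := summable_ofReal_mul_pow hs0 hs hf.1 hw
    have hA : Summable fun i => (f (i + L) : ℂ) * w ^ (i + L) :=
      hS1.comp_injective (add_left_injective L)
    -- `(1 - w) ∑_{n ≥ L} f_n w^n = f_L w^L + w ∑_{n ≥ L} (f_{n+1} - f_n) w^n`
    have hparts : (∑' i : ℕ, (f (i + L) : ℂ) * w ^ (i + L)) * (1 - w) =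
        (f L : ℂ) * w ^ L + w * ∑' i : ℕ, ((f (i + L + 1) - f (i + L) : ℝ) : ℂ) * w ^ (i + L) := by
      have h1 := hA.tsum_eq_zero_add
      have hA' : Summable fun i => (f (i + 1 + L) : ℂ) * w ^ (i + 1 + L) :=
        hA.comp_injective (add_left_injective 1)
      have h2 : w * ∑' i : ℕ, ((f (i + L + 1) - f (i + L) : ℝ) : ℂ) * w ^ (i + L) =
          ∑' i : ℕ, (f (i + 1 + L) : ℂ) * w ^ (i + 1 + L) -
            w * ∑' i : ℕ, (f (i + L) : ℂ) * w ^ (i + L) := by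
        rw [← tsum_mul_left, ← tsum_mul_left, ← hA'.tsum_sub (hA.mul_left w)]
        refine tsum_congr fun i => ?_
        rw [show i + 1 + L = i + L + 1 by ring]
        push_cast
        ring
      rw [h2, mul_sub, mul_one, mul_comm _ w]
      rw [zero_add] at h1
      nth_rewrite 1 [h1]
      ring
    rw [← norm_mul, hparts]
    have hδ : 0 < ‖1 - w‖ := by
      by_contra h0
      rw [le_antisymm (not_lt.1 h0) (norm_nonneg _)] at hL'
      linarith
    have hfL := hC L
    rw [Real.norm_of_nonneg (hs0 L)] at hfL
    have hind := hC' w hw L hL hL'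
    have h6 : ‖∑' i : ℕ, ((f (i + L + 1) - f (i + L) : ℝ) : ℂ) * w ^ (i + L)‖ ≤ C' * s L := by
      have h7 : C' * (s L / ((L : ℝ) + 1)) ≤ C' * s L * ‖1 - w‖ := by
        have := hs0 L
        rw [mul_assoc]
        gcongr
        rw [div_le_iff₀ (by positivity)]
        nlinarith
      exact le_of_mul_le_mul_right (hind.trans h7) hδ
    calc ‖(f L : ℂ) * w ^ L + w * ∑' i : ℕ, ((f (i + L + 1) - f (i + L) : ℝ) : ℂ) * w ^ (i + L)‖
        ≤ ‖f L‖ * ‖w‖ ^ L +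
          ‖w‖ * ‖∑' i : ℕ, ((f (i + L + 1) - f (i + L) : ℝ) : ℂ) * w ^ (i + L)‖ := by
          refine (norm_add_le _ _).trans (le_of_eq ?_)
          rw [norm_mul, norm_mul, norm_pow, Complex.norm_real]
      _ ≤ ‖f L‖ * 1 + 1 * ‖∑' i : ℕ, ((f (i + L + 1) - f (i + L) : ℝ) : ℂ) * w ^ (i + L)‖ := by
          gcongr
          exact pow_le_one₀ (norm_nonneg w) hw.le
      _ ≤ _ := by linarith

/-! ### Pointwise estimates of the kernel -/

/-- The power series `∑ a_n w^n` of the kernel: `B^ω_z(ζ)` is its value at `w = z̄ ζ`. -/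
def kernelFun (ω : ℝ → ℝ) (w : ℂ) : ℂ := ∑' n, (kernelCoeff ω n : ℂ) * w ^ n

namespace UpperDoubling

variable {ω : ℝ → ℝ}

lemma summable_natCast_mul_kernelCoeff (hω : ω ∈ UpperDoubling) {r : ℝ} (hr : r ∈ Ico (0 : ℝ) 1) :
    Summable fun n : ℕ => ((n : ℝ) + 1) * kernelCoeff ω n * r ^ n := by
  obtain ⟨q, hq⟩ := exists_kernelCoeff_antitone hω
  have h := hω.1
  have h1 : Summable fun n : ℕ => ((n : ℝ) + 1) ^ (q + 1) * r ^ n := by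
    have h2 : Summable fun n : ℕ => (2 * (n : ℝ) ^ (q + 1) * r ^ n + r ^ n) * 2 ^ q := by
      have h3 := summable_pow_mul_geometric_of_norm_lt_one (R := ℝ) (q + 1)
        (r := r) (by rw [Real.norm_of_nonneg hr.1]; exact hr.2)
      have h4 := summable_geometric_of_lt_one hr.1 hr.2
      simpa only [mul_assoc] using ((h3.mul_left 2).add h4).mul_right (2 ^ q)
    refine h2.of_nonneg_of_le (fun n => mul_nonneg (by positivity) (pow_nonneg hr.1 n)) fun n => ?_
    have h5 := add_pow_le (a := (n : ℝ)) (b := 1) n.cast_nonneg zero_le_one (q + 1)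
    have h6 := pow_nonneg hr.1 n
    have h7 : ((n : ℝ) + 1) ^ (q + 1) ≤ (2 * (n : ℝ) ^ (q + 1) + 1) * 2 ^ q := by
      refine h5.trans ?_
      rw [one_pow, Nat.add_sub_cancel, mul_comm]
      gcongr
      have : 0 ≤ (n : ℝ) ^ (q + 1) := by positivity
      linarith
    calc ((n : ℝ) + 1) ^ (q + 1) * r ^ n ≤ (2 * (n : ℝ) ^ (q + 1) + 1) * 2 ^ q * r ^ n := by gcongr
      _ = _ := by ring
  refine (h1.mul_left (kernelCoeff ω 0)).of_nonneg_of_le (fun n => ?_) fun n => ?_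
  · have := (h.kernelCoeff_pos n).le
    exact mul_nonneg (by positivity) (pow_nonneg hr.1 n)
  · have h2 := hq (Nat.zero_le n)
    simp only [Nat.cast_zero, zero_add, one_pow, div_one] at h2
    rw [div_le_iff₀ (by positivity)] at h2
    calc ((n : ℝ) + 1) * kernelCoeff ω n * r ^ n
        ≤ ((n : ℝ) + 1) * (kernelCoeff ω 0 * ((n : ℝ) + 1) ^ q) * r ^ n := by
          have := pow_nonneg hr.1 n
          gcongr
      _ = _ := by ring

lemma summable_kernelCoeff (hω : ω ∈ UpperDoubling) {r : ℝ} (hr : r ∈ Ico (0 : ℝ) 1) :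
    Summable fun n : ℕ => kernelCoeff ω n * r ^ n := by
  refine (summable_natCast_mul_kernelCoeff hω hr).of_nonneg_of_le
    (fun n => mul_nonneg (hω.1.kernelCoeff_pos n).le (pow_nonneg hr.1 n)) fun n => ?_
  have h1 := mul_nonneg (hω.1.kernelCoeff_pos n).le (pow_nonneg hr.1 n)
  have h2 := n.cast_nonneg (α := ℝ)
  nlinarith

lemma summable_kernelFun (hω : ω ∈ UpperDoubling) {w : ℂ} (hw : ‖w‖ < 1) :
    Summable fun n => (kernelCoeff ω n : ℂ) * w ^ n :=
  summable_ofReal_mul_pow (fun n => (hω.1.kernelCoeff_pos n).le) (fun _ => summable_kernelCoeff hω)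
    (Asymptotics.isBigO_refl _ _) hw

/-- Upper bound `|B(w)| ≤ C / (δ ω̂(1 - δ))` with `δ = |1 - w|`. -/
lemma exists_norm_kernelFun_le (hω : ω ∈ UpperDoubling) :
    ∃ C : ℝ, 0 < C ∧ ∀ w : ℂ, ‖w‖ < 1 →
      ‖kernelFun ω w‖ ≤ C / (‖1 - w‖ * tailAt ω ‖1 - w‖) := by
  have h := hω.1
  obtain ⟨q, hq⟩ := exists_kernelCoeff_antitone hω
  obtain ⟨C₁, hC₁0, hC₁⟩ := exists_norm_tsum_tail_le (q + 2) (fun n => (h.kernelCoeff_pos n).le)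
    (fun _ => summable_kernelCoeff hω) (symbolBound_kernelCoeff hω (q + 2))
    (summable_and_tsum_div_pow_le (fun n => (h.kernelCoeff_pos n).le) hq)
  obtain ⟨C₂, hC₂0, hC₂⟩ := exists_kernelCoeff_le hω
  obtain ⟨C₃, hC₃0, hC₃⟩ := exists_tailAt_mul_le hω 3
  refine ⟨(1 + C₁) * C₂ * C₃, by positivity, fun w hw => ?_⟩
  have hδ0 : 0 < ‖1 - w‖ := by
    rw [norm_pos_iff, sub_ne_zero]
    rintro rfl
    simp at hw
  have hδ2 : ‖1 - w‖ ≤ 2 := (norm_sub_le _ _).trans (by rw [norm_one]; linarith)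
  set δ := ‖1 - w‖ with hδ
  set L : ℕ := ⌊1 / δ⌋₊ with hL
  have hL1 : (L : ℝ) * δ ≤ 1 := by
    rw [← le_div_iff₀ hδ0]
    exact Nat.floor_le (by positivity)
  have hL2 : 1 ≤ ((L : ℝ) + 1) * δ := by
    rw [← div_le_iff₀ hδ0]
    exact (Nat.lt_floor_add_one _).le
  have haL := h.kernelCoeff_pos L
  have hbound : ‖kernelFun ω w‖ * δ ≤ (1 + C₁) * kernelCoeff ω L := by
    rw [kernelFun, ← (summable_kernelFun hω hw).sum_add_tsum_nat_add L]
    have h1 : ‖∑ n ∈ Finset.range L, (kernelCoeff ω n : ℂ) * w ^ n‖ ≤ L * kernelCoeff ω L := by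
      refine (norm_sum_le_of_le _ (f := fun n => (kernelCoeff ω n : ℂ) * w ^ n)
        (n := fun _ => kernelCoeff ω L) fun n hn => ?_).trans ?_
      · rw [norm_mul, norm_pow, Complex.norm_real, Real.norm_of_nonneg (h.kernelCoeff_pos n).le]
        calc kernelCoeff ω n * ‖w‖ ^ n ≤ kernelCoeff ω n * 1 := by
              have := (h.kernelCoeff_pos n).le
              gcongr
              exact pow_le_one₀ (norm_nonneg w) hw.le
          _ ≤ _ := by
              rw [mul_one]
              exact h.kernelCoeff_monotone (Finset.mem_range.1 hn).le
      · simp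
    have h2 := hC₁ w hw L hL1 hL2
    calc _ ≤ (‖∑ n ∈ Finset.range L, (kernelCoeff ω n : ℂ) * w ^ n‖ +
            ‖∑' i : ℕ, (kernelCoeff ω (i + L) : ℂ) * w ^ (i + L)‖) * δ := by
          gcongr
          exact norm_add_le _ _
      _ ≤ (L * kernelCoeff ω L) * δ + C₁ * kernelCoeff ω L := by
          rw [add_mul]
          gcongr
      _ = (L * δ) * kernelCoeff ω L + C₁ * kernelCoeff ω L := by ring
      _ ≤ 1 * kernelCoeff ω L + C₁ * kernelCoeff ω L := by gcongr
      _ = _ := by ring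
  have hT := hC₃ δ (1 / ((L : ℝ) + 1)) hδ0 (by positivity) (by
    rw [mul_one_div, le_div_iff₀ (by positivity)]
    linarith)
  have hTδ := h.tailAt_pos hδ0
  have hTL := h.tailAt_pos (show 0 < 1 / ((L : ℝ) + 1) by positivity)
  rw [le_div_iff₀ (by positivity)]
  calc ‖kernelFun ω w‖ * (δ * tailAt ω δ) = ‖kernelFun ω w‖ * δ * tailAt ω δ := by ring
    _ ≤ (1 + C₁) * kernelCoeff ω L * (C₃ * tailAt ω (1 / ((L : ℝ) + 1))) := by gcongr
    _ = (1 + C₁) * (kernelCoeff ω L * tailAt ω (1 / ((L : ℝ) + 1))) * C₃ := by ring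
    _ ≤ _ := by
        gcongr
        exact hC₂ L

/-- Lower bound for the kernel on the positive radius. -/
lemma exists_le_tsum_kernelCoeff (hω : ω ∈ UpperDoubling) :
    ∃ c : ℝ, 0 < c ∧ ∀ r ∈ Ico (0 : ℝ) 1,
      c / ((1 - r) * tailAt ω (1 - r)) ≤ ∑' n, kernelCoeff ω n * r ^ n := by
  have h := hω.1
  obtain ⟨c₁, hc₁0, hc₁⟩ := exists_le_kernelCoeff hω
  obtain ⟨C₂, hC₂0, hC₂⟩ := exists_tailAt_mul_le hω 2
  refine ⟨c₁ / (2 * C₂), by positivity, fun r hr => ?_⟩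
  set x := 1 - r with hx
  have hx0 : 0 < x := by linarith [hr.2]
  have hx1 : x ≤ 1 := by linarith [hr.1]
  set K : ℕ := ⌊1 / (2 * x)⌋₊ with hK
  have hK1 : (K : ℝ) * x ≤ 1 / 2 := by
    have h1 : (K : ℝ) ≤ 1 / (2 * x) := Nat.floor_le (by positivity)
    calc (K : ℝ) * x ≤ 1 / (2 * x) * x := by gcongr
      _ = 1 / 2 := by field_simp
  have hK2 : 1 / ((K : ℝ) + 1) ≤ 2 * x := by
    rw [div_le_iff₀ (by positivity), mul_comm, ← div_le_iff₀ (by positivity)]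
    exact (Nat.lt_floor_add_one _).le
  have hrK : 1 / 2 ≤ r ^ K := by
    have hb := one_add_mul_le_pow (a := -x) (by linarith) K
    have e : 1 + -x = r := by rw [hx]; ring
    rw [e] at hb
    linarith
  have hS := summable_kernelCoeff hω hr
  have haK := h.kernelCoeff_pos K
  have hgeo := summable_geometric_of_lt_one hr.1 hr.2
  have h2 : kernelCoeff ω K * r ^ K * (1 - r)⁻¹ ≤ ∑' n, kernelCoeff ω n * r ^ n := by
    rw [← hS.sum_add_tsum_nat_add K, ← tsum_geometric_of_lt_one hr.1 hr.2, ← tsum_mul_left]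
    refine le_add_of_nonneg_of_le (Finset.sum_nonneg fun n _ =>
      mul_nonneg (h.kernelCoeff_pos n).le (pow_nonneg hr.1 n)) ?_
    refine (hgeo.mul_left _).tsum_le_tsum (fun n => ?_) (hS.comp_injective (add_left_injective K))
    have h3 : kernelCoeff ω K ≤ kernelCoeff ω (n + K) := h.kernelCoeff_monotone (by omega)
    calc kernelCoeff ω K * r ^ K * r ^ n = kernelCoeff ω K * r ^ (n + K) := by ring
      _ ≤ _ := mul_le_mul_of_nonneg_right h3 (pow_nonneg hr.1 _)
  refine le_trans ?_ h2
  have hT := hC₂ (1 / ((K : ℝ) + 1)) x (by positivity) hx0 hK2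
  have hTx := h.tailAt_pos hx0
  have h4 : c₁ ≤ kernelCoeff ω K * (C₂ * tailAt ω x) :=
    (hc₁ K).trans (mul_le_mul_of_nonneg_left hT haK.le)
  rw [← hx, div_div, div_le_iff₀ (by positivity)]
  calc c₁ ≤ kernelCoeff ω K * (C₂ * tailAt ω x) := h4
    _ = kernelCoeff ω K * (1 / 2) * x⁻¹ * (2 * C₂ * (x * tailAt ω x)) := by field_simp
    _ ≤ kernelCoeff ω K * r ^ K * x⁻¹ * (2 * C₂ * (x * tailAt ω x)) := by gcongr

/-- The derivative of the kernel on the radius is at most a constant times `B(r) / (1 - r)`: multiplying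
`∑ n a_n r^n` by `1 - r` replaces `n a_n` by its first difference, which is `O(a_n)`. -/
lemma exists_tsum_natCast_mul_kernelCoeff_le (hω : ω ∈ UpperDoubling) :
    ∃ C : ℝ, 0 < C ∧ ∀ r ∈ Ico (0 : ℝ) 1,
      (1 - r) * ∑' n : ℕ, (n : ℝ) * kernelCoeff ω n * r ^ n ≤
        C * ∑' n, kernelCoeff ω n * r ^ n := by
  have h := hω.1
  obtain ⟨C, hC0, hC⟩ := Asymptotics.IsBigO.exists_pos (symbolBound_kernelCoeff hω 1).2
  have hC := eventually_top.1 hC.bound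
  refine ⟨C + 1, by positivity, fun r hr => ?_⟩
  have hS := summable_kernelCoeff hω hr
  have hD : Summable fun n : ℕ => (n : ℝ) * kernelCoeff ω n * r ^ n := by
    refine ((summable_natCast_mul_kernelCoeff hω hr).sub hS).congr fun n => ?_
    ring
  have hS1 : Summable fun n : ℕ => kernelCoeff ω (n + 1) * r ^ (n + 1) :=
    hS.comp_injective (add_left_injective 1)
  have hD1 : Summable fun n : ℕ => ((n + 1 : ℕ) : ℝ) * kernelCoeff ω (n + 1) * r ^ (n + 1) :=
    hD.comp_injective (add_left_injective 1)
  have e : (1 - r) * ∑' n : ℕ, (n : ℝ) * kernelCoeff ω n * r ^ n =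
      ∑' n : ℕ, (((n + 1 : ℕ) : ℝ) * kernelCoeff ω (n + 1) * r ^ (n + 1) -
        r * ((n : ℝ) * kernelCoeff ω n * r ^ n)) := by
    rw [hD1.tsum_sub (hD.mul_left r), tsum_mul_left, sub_mul, one_mul]
    nth_rewrite 1 [hD.tsum_eq_zero_add]
    simp
  rw [e]
  have h2 : ∑' n : ℕ, (((n + 1 : ℕ) : ℝ) * kernelCoeff ω (n + 1) * r ^ (n + 1) -
        r * ((n : ℝ) * kernelCoeff ω n * r ^ n)) ≤
      ∑' n : ℕ, (C + 1) * (kernelCoeff ω (n + 1) * r ^ (n + 1)) := by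
    refine (hD1.sub (hD.mul_left r)).tsum_le_tsum (fun n => ?_) (hS1.mul_left _)
    have h3 := hC n
    have han := h.kernelCoeff_pos n
    have hmono : kernelCoeff ω n ≤ kernelCoeff ω (n + 1) := h.kernelCoeff_monotone (by omega)
    rw [Real.norm_of_nonneg (by linarith), Real.norm_of_nonneg (by positivity), mul_div_assoc',
      le_div_iff₀ (by positivity)] at h3
    have h4 : ((n : ℝ) + 1) * kernelCoeff ω (n + 1) - n * kernelCoeff ω n ≤
        (C + 1) * kernelCoeff ω (n + 1) := by nlinarith
    push_cast
    calc ((n : ℝ) + 1) * kernelCoeff ω (n + 1) * r ^ (n + 1) - r * (n * kernelCoeff ω n * r ^ n)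
        = (((n : ℝ) + 1) * kernelCoeff ω (n + 1) - n * kernelCoeff ω n) * r ^ (n + 1) := by ring
      _ ≤ (C + 1) * kernelCoeff ω (n + 1) * r ^ (n + 1) :=
          mul_le_mul_of_nonneg_right h4 (pow_nonneg hr.1 _)
      _ = _ := by ring
  refine h2.trans ?_
  rw [tsum_mul_left, hS.tsum_eq_zero_add]
  gcongr
  have := (h.kernelCoeff_pos 0).le
  simpa using this

/-- In the sector `|θ| ≤ ε (1 - r)` the kernel is as large as on the radius. -/
lemma exists_le_norm_kernelFun (hω : ω ∈ UpperDoubling) :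
    ∃ c ε : ℝ, 0 < c ∧ 0 < ε ∧ ε ≤ 1 ∧ ∀ r ∈ Ico (0 : ℝ) 1, ∀ θ : ℝ, |θ| ≤ ε * (1 - r) →
      c / ((1 - r) * tailAt ω (1 - r)) ≤ ‖kernelFun ω (r * Complex.exp (θ * Complex.I))‖ := by
  have h := hω.1
  obtain ⟨c, hc0, hc⟩ := exists_le_tsum_kernelCoeff hω
  obtain ⟨C, hC0, hC⟩ := exists_tsum_natCast_mul_kernelCoeff_le hω
  refine ⟨c / 2, min 1 (1 / (2 * C)), by positivity, by positivity, min_le_left _ _,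
    fun r hr θ hθ => ?_⟩
  have hx : 0 < 1 - r := by linarith [hr.2]
  set w : ℂ := r * Complex.exp (θ * Complex.I) with hw
  have hrn : ‖(r : ℂ)‖ = r := by rw [Complex.norm_real, Real.norm_of_nonneg hr.1]
  have hwn : ‖w‖ = r := by rw [hw, norm_mul, Complex.norm_exp_ofReal_mul_I, mul_one, hrn]
  have hS := summable_kernelCoeff hω hr
  have hD : Summable fun n : ℕ => (n : ℝ) * kernelCoeff ω n * r ^ n := by
    refine ((summable_natCast_mul_kernelCoeff hω hr).sub hS).congr fun n => ?_
    ring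
  have hB : kernelFun ω (r : ℂ) = ((∑' n, kernelCoeff ω n * r ^ n : ℝ) : ℂ) := by
    rw [kernelFun, Complex.ofReal_tsum]
    push_cast
    rfl
  have hB0 : 0 ≤ ∑' n, kernelCoeff ω n * r ^ n :=
    tsum_nonneg fun n => mul_nonneg (h.kernelCoeff_pos n).le (pow_nonneg hr.1 n)
  have hdiff : ‖kernelFun ω (r : ℂ) - kernelFun ω w‖ ≤
      |θ| * ∑' n : ℕ, (n : ℝ) * kernelCoeff ω n * r ^ n := by
    rw [kernelFun, kernelFun, ← (summable_kernelFun hω (by rw [hrn]; exact hr.2)).tsum_sub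
      (summable_kernelFun hω (by rw [hwn]; exact hr.2)), ← tsum_mul_left]
    refine tsum_of_norm_bounded (hD.mul_left _).hasSum fun n => ?_
    have e : (kernelCoeff ω n : ℂ) * (r : ℂ) ^ n - (kernelCoeff ω n : ℂ) * w ^ n =
        -((kernelCoeff ω n : ℂ) * (r : ℂ) ^ n * (Complex.exp (Complex.I * ((n * θ : ℝ) : ℂ)) - 1)) := by
      rw [hw, mul_pow, ← Complex.exp_nat_mul]
      push_cast
      rw [show Complex.I * ((n : ℂ) * (θ : ℂ)) = (n : ℂ) * ((θ : ℂ) * Complex.I) by ring]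
      ring
    rw [e, norm_neg, norm_mul, norm_mul, norm_pow, hrn, Complex.norm_real,
      Real.norm_of_nonneg (h.kernelCoeff_pos n).le]
    have h1 := Real.norm_exp_I_mul_ofReal_sub_one_le (x := n * θ)
    rw [Real.norm_eq_abs, abs_mul, abs_of_nonneg (n.cast_nonneg (α := ℝ))] at h1
    calc kernelCoeff ω n * r ^ n * ‖Complex.exp (Complex.I * ((n * θ : ℝ) : ℂ)) - 1‖
        ≤ kernelCoeff ω n * r ^ n * (n * |θ|) :=
          mul_le_mul_of_nonneg_left h1 (mul_nonneg (h.kernelCoeff_pos n).le (pow_nonneg hr.1 n))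
      _ = _ := by ring
  have hD0 : 0 ≤ ∑' n : ℕ, (n : ℝ) * kernelCoeff ω n * r ^ n :=
    tsum_nonneg fun n => mul_nonneg (mul_nonneg n.cast_nonneg (h.kernelCoeff_pos n).le)
      (pow_nonneg hr.1 n)
  have hhalf : |θ| * ∑' n : ℕ, (n : ℝ) * kernelCoeff ω n * r ^ n ≤
      1 / 2 * ∑' n, kernelCoeff ω n * r ^ n := by
    calc |θ| * ∑' n : ℕ, (n : ℝ) * kernelCoeff ω n * r ^ n
        ≤ (1 / (2 * C) * (1 - r)) * ∑' n : ℕ, (n : ℝ) * kernelCoeff ω n * r ^ n := by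
          gcongr
          exact hθ.trans (mul_le_mul_of_nonneg_right (min_le_right _ _) hx.le)
      _ = 1 / (2 * C) * ((1 - r) * ∑' n : ℕ, (n : ℝ) * kernelCoeff ω n * r ^ n) := by ring
      _ ≤ 1 / (2 * C) * (C * ∑' n, kernelCoeff ω n * r ^ n) := by
          exact mul_le_mul_of_nonneg_left (hC r hr) (by positivity)
      _ = _ := by field_simp
  have h1 := norm_sub_norm_le (kernelFun ω (r : ℂ)) (kernelFun ω w)
  rw [hB, Complex.norm_real, Real.norm_of_nonneg hB0, ← hB] at h1
  have h2 := hc r hr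
  rw [div_right_comm]
  linarith

end UpperDoubling

/-! ### Polar coordinates for radial weights -/

/-- The point `r e^{iθ}`. -/
def polarPoint (q : ℝ × ℝ) : ℂ := q.1 * Complex.exp (q.2 * Complex.I)

lemma continuous_polarPoint : Continuous polarPoint := by
  unfold polarPoint; fun_prop

lemma norm_polarPoint {s : ℝ} (hs : 0 ≤ s) (θ : ℝ) : ‖polarPoint (s, θ)‖ = s := by
  simp [polarPoint, Complex.norm_exp_ofReal_mul_I, abs_of_nonneg hs]

lemma lintegral_ball_eq_polar {F : ℂ → ℝ≥0∞} (hF : Measurable F) :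
    ∫⁻ ζ in Metric.ball (0 : ℂ) 1, F ζ =
      ∫⁻ s in Ico (0 : ℝ) 1, ENNReal.ofReal s * ∫⁻ θ in Ioo (-Real.pi) Real.pi, F (polarPoint (s, θ)) := by
  rw [← lintegral_indicator Metric.isOpen_ball.measurableSet, ← Complex.lintegral_comp_polarCoord_symm,
    polarCoord_target, Measure.volume_eq_prod, ← Measure.prod_restrict]
  have hF' : Measurable ((Metric.ball (0 : ℂ) 1).indicator F) :=
    hF.indicator Metric.isOpen_ball.measurableSet
  have e : ∀ q : ℝ × ℝ, Complex.polarCoord.symm q = polarPoint q := fun q => by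
    rw [Complex.polarCoord_symm_apply, polarPoint, Complex.exp_mul_I]
    push_cast; rfl
  simp only [e, smul_eq_mul]
  have hm : Measurable fun q : ℝ × ℝ =>
      ENNReal.ofReal q.1 * (Metric.ball (0 : ℂ) 1).indicator F (polarPoint q) :=
    (ENNReal.measurable_ofReal.comp measurable_fst).mul
      (hF'.comp continuous_polarPoint.measurable)
  rw [lintegral_prod _ hm.aemeasurable]
  have h1 : ∫⁻ s in Ico (0 : ℝ) 1, ENNReal.ofReal s *
        ∫⁻ θ in Ioo (-Real.pi) Real.pi, F (polarPoint (s, θ)) =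
      ∫⁻ s in Ioo (0 : ℝ) 1, ENNReal.ofReal s *
        ∫⁻ θ in Ioo (-Real.pi) Real.pi, F (polarPoint (s, θ)) :=
    (setLIntegral_congr Ioo_ae_eq_Ico).symm
  rw [h1, ← lintegral_indicator measurableSet_Ioo, ← lintegral_indicator measurableSet_Ioi]
  refine lintegral_congr fun s => ?_
  by_cases hs0 : s ∈ Ioi (0 : ℝ)
  · rw [indicator_of_mem hs0]
    have hmeas : Measurable fun θ : ℝ => (Metric.ball (0 : ℂ) 1).indicator F (polarPoint (s, θ)) :=
      hF'.comp (continuous_polarPoint.measurable.comp (by fun_prop))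
    dsimp only
    rw [lintegral_const_mul _ hmeas]
    by_cases hs1 : s < 1
    · rw [indicator_of_mem (show s ∈ Ioo (0 : ℝ) 1 from ⟨hs0, hs1⟩)]
      congr 1
      refine lintegral_congr fun θ => indicator_of_mem ?_ _
      rw [mem_ball_zero_iff, norm_polarPoint (le_of_lt hs0)]
      exact hs1
    · rw [indicator_of_notMem (fun hh : s ∈ Ioo (0 : ℝ) 1 => hs1 hh.2)]
      have : ∀ θ, (Metric.ball (0 : ℂ) 1).indicator F (polarPoint (s, θ)) = 0 := fun θ => by
        refine indicator_of_notMem ?_ _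
        rw [mem_ball_zero_iff, norm_polarPoint (le_of_lt hs0)]
        exact hs1
      simp [this]
  · rw [indicator_of_notMem hs0, indicator_of_notMem fun hh : s ∈ Ioo (0 : ℝ) 1 => hs0 hh.1]

/-- A null set of radii gives a null set of points of the disc. -/
lemma ae_comp_norm {P : ℝ → Prop} (hP : ∀ᵐ r ∂(volume.restrict (Ico (0 : ℝ) 1)), P r) :
    ∀ᵐ ζ ∂(volume.restrict (Metric.ball (0 : ℂ) 1)), P ‖ζ‖ := by
  obtain ⟨E, hE, hEm, hE0⟩ := exists_measurable_superset_of_null (ae_iff.1 hP)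
  have hmeas : MeasurableSet {ζ : ℂ | ‖ζ‖ ∈ E} := measurable_norm hEm
  have h0 : (volume.restrict (Metric.ball (0 : ℂ) 1)) {ζ : ℂ | ‖ζ‖ ∈ E} = 0 := by
    rw [← lintegral_indicator_one hmeas, lintegral_ball_eq_polar (measurable_one.indicator hmeas)]
    rw [lintegral_eq_zero_iff']
    · have hE' : ∀ᵐ s ∂(volume.restrict (Ico (0 : ℝ) 1)), s ∉ E := measure_eq_zero_iff_ae_notMem.1 hE0
      filter_upwards [hE', ae_restrict_mem measurableSet_Ico] with s hs hs0
      have : ∀ θ, ({ζ : ℂ | ‖ζ‖ ∈ E}.indicator 1 (polarPoint (s, θ)) : ℝ≥0∞) = 0 := fun θ => by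
        refine indicator_of_notMem ?_ _
        change ‖polarPoint (s, θ)‖ ∉ E
        rw [norm_polarPoint hs0.1]
        exact hs
      simp [this]
    · refine (ENNReal.measurable_ofReal.mul ?_).aemeasurable
      exact Measurable.lintegral_prod_right' (f := fun q : ℝ × ℝ =>
        ({ζ : ℂ | ‖ζ‖ ∈ E}.indicator 1 (polarPoint q) : ℝ≥0∞))
        ((measurable_one.indicator hmeas).comp continuous_polarPoint.measurable)
  refine measure_mono_null (fun ζ hζ => hE hζ) h0

namespace IsRadialWeight

variable {ν : ℝ → ℝ}

lemma lintegral_weightedArea (h : IsRadialWeight ν) {F : ℂ → ℝ≥0∞} (hF : Measurable F) :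
    ∫⁻ ζ, F ζ ∂(weightedArea ν) = ∫⁻ s, ENNReal.ofReal (s / Real.pi) *
      (∫⁻ θ in Ioo (-Real.pi) Real.pi, F (polarPoint (s, θ))) ∂(profileMeasure ν) := by
  have hg : AEMeasurable (fun r => ENNReal.ofReal (ν r)) (volume.restrict (Ico (0 : ℝ) 1)) :=
    h.integrableOn.aestronglyMeasurable.aemeasurable.ennreal_ofReal
  set g := hg.mk with hgdef
  have hgm : Measurable g := hg.measurable_mk
  have hae := hg.ae_eq_mk
  have h1 : weightedArea ν = diskArea.withDensity fun ζ => g ‖ζ‖ := by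
    refine withDensity_congr_ae ?_
    exact Measure.ae_smul_measure (ae_comp_norm hae) _
  have h2 : profileMeasure ν = (volume.restrict (Ico (0 : ℝ) 1)).withDensity g :=
    withDensity_congr_ae hae
  have hinner : Measurable fun s : ℝ => ∫⁻ θ in Ioo (-Real.pi) Real.pi, F (polarPoint (s, θ)) :=
    Measurable.lintegral_prod_right' (f := fun q : ℝ × ℝ => F (polarPoint q))
      (hF.comp continuous_polarPoint.measurable)
  have hgn : Measurable fun ζ : ℂ => g ‖ζ‖ := hgm.comp measurable_norm
  have h3 := lintegral_withDensity_eq_lintegral_mul (volume.restrict (Ico (0 : ℝ) 1)) hgm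
    (g := fun s => ENNReal.ofReal (s / Real.pi) *
      ∫⁻ θ in Ioo (-Real.pi) Real.pi, F (polarPoint (s, θ)))
    ((ENNReal.measurable_ofReal.comp (by fun_prop)).mul hinner)
  rw [h1, h2, lintegral_withDensity_eq_lintegral_mul _ hgn hF, diskArea, lintegral_smul_measure,
    lintegral_ball_eq_polar (hgn.mul hF), h3, smul_eq_mul,
    ← lintegral_const_mul' _ _ (ENNReal.inv_ne_top.2 (by simpa using Real.pi_pos))]
  refine setLIntegral_congr_fun measurableSet_Ico fun s hs => ?_
  simp only [Pi.mul_apply]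
  have e : ∀ θ, g ‖polarPoint (s, θ)‖ = g s := fun θ => by rw [norm_polarPoint hs.1]
  simp only [e]
  have hFs : Measurable fun θ : ℝ => F (polarPoint (s, θ)) :=
    hF.comp (continuous_polarPoint.measurable.comp (by fun_prop))
  rw [lintegral_const_mul _ hFs, ENNReal.ofReal_div_of_pos Real.pi_pos, div_eq_mul_inv]
  ring

/-- The measure `ω dA` as the image of a product measure under polar coordinates. -/
lemma weightedArea_eq_map (h : IsRadialWeight ν) :
    weightedArea ν = (((profileMeasure ν).withDensity fun s => ENNReal.ofReal (s / Real.pi)).prod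
      (volume.restrict (Ioo (-Real.pi) Real.pi))).map polarPoint := by
  have := h.isFiniteMeasure
  refine Measure.ext fun A hA => ?_
  have hm : Measurable (A.indicator (1 : ℂ → ℝ≥0∞)) := measurable_one.indicator hA
  rw [← lintegral_indicator_one hA, ← lintegral_indicator_one hA, h.lintegral_weightedArea hm,
    lintegral_map hm continuous_polarPoint.measurable,
    lintegral_prod (fun q => A.indicator 1 (polarPoint q))
      (hm.comp continuous_polarPoint.measurable).aemeasurable,
    lintegral_withDensity_eq_lintegral_mul _ (by fun_prop)]
  · simp only [Pi.mul_apply]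
  · exact Measurable.lintegral_prod_right' (f := fun q : ℝ × ℝ => A.indicator 1 (polarPoint q))
      (hm.comp continuous_polarPoint.measurable)

lemma isFiniteMeasure_weightedArea (h : IsRadialWeight ν) : IsFiniteMeasure (weightedArea ν) := by
  have := h.isFiniteMeasure
  refine ⟨?_⟩
  rw [← lintegral_one, h.lintegral_weightedArea measurable_const]
  have hle : ∫⁻ s, ENNReal.ofReal (s / Real.pi) * (∫⁻ _ in Ioo (-Real.pi) Real.pi, 1)
      ∂(profileMeasure ν) ≤ ∫⁻ _, 2 ∂(profileMeasure ν) := by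
    refine lintegral_mono_ae ?_
    filter_upwards [ae_profileMeasure] with s hs
    rw [lintegral_one, Measure.restrict_apply_univ, Real.volume_Ioo,
      ← ENNReal.ofReal_mul (div_nonneg hs.1 Real.pi_pos.le), show (2 : ℝ≥0∞) = ENNReal.ofReal 2 by simp]
    refine ENNReal.ofReal_le_ofReal ?_
    have e : s / Real.pi * (Real.pi - -Real.pi) = 2 * s := by
      field_simp; ring
    rw [e]
    linarith [hs.2]
  refine hle.trans_lt ?_
  rw [lintegral_const]
  exact ENNReal.mul_lt_top (by simp) (measure_lt_top _ _)

end IsRadialWeight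

lemma ae_weightedArea_mem_ball {ν : ℝ → ℝ} :
    ∀ᵐ ζ ∂(weightedArea ν), ζ ∈ Metric.ball (0 : ℂ) 1 :=
  (withDensity_absolutelyContinuous _ _).ae_le
    (Measure.ae_smul_measure (ae_restrict_mem Metric.isOpen_ball.measurableSet) _)

lemma aestronglyMeasurable_weightedArea {ν : ℝ → ℝ} {f : ℂ → ℂ}
    (hf : ContinuousOn f (Metric.ball 0 1)) : AEStronglyMeasurable f (weightedArea ν) :=
  ((hf.aestronglyMeasurable Metric.isOpen_ball.measurableSet).smul_measure _).mono_ac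
    (withDensity_absolutelyContinuous _ _)

/-! ### Identification of the Bergman kernel -/

lemma integral_exp_natCast_mul (m n : ℕ) :
    ∫ θ in Ioo (-Real.pi) Real.pi,
        Complex.exp (θ * Complex.I) ^ m * conj (Complex.exp (θ * Complex.I)) ^ n =
      if m = n then 2 * (Real.pi : ℂ) else 0 := by
  have e : ∀ θ : ℝ, Complex.exp (θ * Complex.I) ^ m * conj (Complex.exp (θ * Complex.I)) ^ n =
      Complex.exp (((m : ℂ) - n) * Complex.I * θ) := fun θ => by
    rw [← Complex.exp_conj, ← Complex.exp_nat_mul, ← Complex.exp_nat_mul, ← Complex.exp_add]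
    congr 1
    simp
    ring
  simp only [e]
  rw [← integral_Ioc_eq_integral_Ioo, ← intervalIntegral.integral_of_le (by linarith [Real.pi_pos])]
  split_ifs with hmn
  · subst hmn
    simp
    ring
  · have hc : ((m : ℂ) - n) * Complex.I ≠ 0 :=
      mul_ne_zero (sub_ne_zero.2 (by exact_mod_cast hmn)) Complex.I_ne_zero
    rw [integral_exp_mul_complex hc, div_eq_zero_iff]
    left
    rw [sub_eq_zero, Complex.exp_eq_exp_iff_exists_int]
    refine ⟨(m : ℤ) - n, ?_⟩
    push_cast
    ring

/-- On each circle, integration against `ζ̄ ^ n` picks out the `n`-th Taylor coefficient. -/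
lemma integral_circle_mul_conj_pow {f : ℂ → ℂ} {c : ℕ → ℂ}
    (hf : ∀ ζ ∈ Metric.ball (0 : ℂ) 1, HasSum (fun n => c n * ζ ^ n) (f ζ)) (n : ℕ) {s : ℝ}
    (hs : s ∈ Ico (0 : ℝ) 1) :
    ∫ θ in Ioo (-Real.pi) Real.pi, f (polarPoint (s, θ)) * conj (polarPoint (s, θ)) ^ n =
      2 * Real.pi * c n * (s : ℂ) ^ (2 * n) := by
  have hball : ∀ θ : ℝ, polarPoint (s, θ) ∈ Metric.ball (0 : ℂ) 1 := fun θ => by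
    rw [mem_ball_zero_iff, norm_polarPoint hs.1]; exact hs.2
  set F : ℕ → ℝ → ℂ := fun m θ => c m * polarPoint (s, θ) ^ m * conj (polarPoint (s, θ)) ^ n with hF
  have hcont : ∀ m, Continuous (F m) := fun m => by
    have : Continuous fun θ : ℝ => polarPoint (s, θ) := continuous_polarPoint.comp (by fun_prop)
    fun_prop
  have hint : ∀ m, Integrable (F m) (volume.restrict (Ioo (-Real.pi) Real.pi)) := fun m =>
    ((hcont m).integrableOn_Icc).mono_set Ioo_subset_Icc_self
  have hnorm : ∀ m θ, ‖F m θ‖ = ‖c m * (s : ℂ) ^ m‖ * s ^ n := fun m θ => by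
    simp only [hF, norm_mul, norm_pow, RCLike.norm_conj, norm_polarPoint hs.1, Complex.norm_real,
      Real.norm_of_nonneg hs.1]
  have hsumm : Summable fun m => ‖c m * (s : ℂ) ^ m‖ :=
    (hf s (by
      rw [mem_ball_zero_iff, Complex.norm_real, Real.norm_of_nonneg hs.1]
      exact hs.2)).summable.norm
  have h1 := hasSum_integral_of_summable_integral_norm hint (by
    simp only [hnorm, integral_const, smul_eq_mul]
    exact (hsumm.mul_right _).mul_left _)
  have h2 : ∀ θ, ∑' m, F m θ = f (polarPoint (s, θ)) * conj (polarPoint (s, θ)) ^ n := fun θ =>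
    ((hf _ (hball θ)).mul_right _).tsum_eq
  simp only [h2] at h1
  refine h1.unique ?_
  have h3 : ∀ m, ∫ θ in Ioo (-Real.pi) Real.pi, F m θ =
      if m = n then 2 * Real.pi * c n * (s : ℂ) ^ (2 * n) else 0 := fun m => by
    have e : ∀ θ, F m θ = c m * (s : ℂ) ^ (m + n) *
        (Complex.exp (θ * Complex.I) ^ m * conj (Complex.exp (θ * Complex.I)) ^ n) := fun θ => by
      simp only [hF, polarPoint, map_mul, Complex.conj_ofReal]
      ring
    simp only [e]
    rw [integral_const_mul, integral_exp_natCast_mul]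
    split_ifs with hmn
    · subst hmn; ring
    · simp
  simp only [h3]
  exact hasSum_ite_eq n _

namespace IsRadialWeight

variable {ω : ℝ → ℝ}

/-- Taylor expansion of an analytic function in `L¹_ω`; the coefficients are read off by integration
against `ζ̄ ^ n`. -/
lemma exists_hasSum_and_integral_eq (h : IsRadialWeight ω) {f : ℂ → ℂ}
    (hd : DifferentiableOn ℂ f (Metric.ball 0 1)) (hi : Integrable f (weightedArea ω)) :
    ∃ c : ℕ → ℂ, (∀ ζ ∈ Metric.ball (0 : ℂ) 1, HasSum (fun n => c n * ζ ^ n) (f ζ)) ∧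
      ∀ n, ∫ ζ, f ζ * conj ζ ^ n ∂(weightedArea ω) = c n * (2 * moment ω (2 * n + 1) : ℝ) := by
  have hfin := h.isFiniteMeasure
  set c : ℕ → ℂ := fun n => (n.factorial : ℂ)⁻¹ * iteratedDeriv n f 0 with hc
  have hf : ∀ ζ ∈ Metric.ball (0 : ℂ) 1, HasSum (fun n => c n * ζ ^ n) (f ζ) := fun ζ hζ => by
    have h1 := Complex.hasSum_taylorSeries_on_ball hd hζ
    have e : (fun n => (n.factorial : ℂ)⁻¹ • (ζ - 0) ^ n • iteratedDeriv n f 0) =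
        fun n => c n * ζ ^ n := by
      funext n
      simp only [sub_zero, smul_eq_mul, hc]
      ring
    rwa [e] at h1
  refine ⟨c, hf, fun n => ?_⟩
  have hi' : Integrable (fun ζ => f ζ * conj ζ ^ n) (weightedArea ω) := by
    refine hi.mul_bdd (c := 1) (by fun_prop) ?_
    filter_upwards [ae_weightedArea_mem_ball] with ζ hζ
    rw [norm_pow, RCLike.norm_conj]
    exact pow_le_one₀ (norm_nonneg _) (mem_ball_zero_iff.1 hζ).le
  rw [h.weightedArea_eq_map] at hi' ⊢
  have hi2 := hi'.comp_measurable continuous_polarPoint.measurable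
  rw [integral_map continuous_polarPoint.aemeasurable hi'.aestronglyMeasurable,
    integral_prod (fun q => f (polarPoint q) * conj (polarPoint q) ^ n) hi2,
    integral_withDensity_eq_integral_toReal_smul (by fun_prop) (by simp)]
  have e : ∀ᵐ s ∂(profileMeasure ω), (ENNReal.ofReal (s / Real.pi)).toReal •
      ∫ θ in Ioo (-Real.pi) Real.pi, f (polarPoint (s, θ)) * conj (polarPoint (s, θ)) ^ n =
      2 * c n * ((s ^ (2 * n + 1) : ℝ) : ℂ) := by
    filter_upwards [ae_profileMeasure] with s hs
    rw [integral_circle_mul_conj_pow hf n hs, ENNReal.toReal_ofReal (div_nonneg hs.1 Real.pi_pos.le),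
      Complex.real_smul]
    have : (Real.pi : ℂ) ≠ 0 := by exact_mod_cast Real.pi_ne_zero
    push_cast
    field_simp
    ring
  rw [integral_congr_ae e, integral_const_mul, integral_complex_ofReal, moment]
  push_cast
  ring

lemma mem_bergmanSpace_of_bound (h : IsRadialWeight ω) {f : ℂ → ℂ}
    (hd : DifferentiableOn ℂ f (Metric.ball 0 1)) {M : ℝ}
    (hM : ∀ ζ ∈ Metric.ball (0 : ℂ) 1, ‖f ζ‖ ≤ M) : f ∈ bergmanSpace 2 ω := by
  have := h.isFiniteMeasure_weightedArea
  refine ⟨hd, MemLp.of_bound (aestronglyMeasurable_weightedArea hd.continuousOn) M ?_⟩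
  filter_upwards [ae_weightedArea_mem_ball] with ζ hζ using hM ζ hζ

end IsRadialWeight

namespace UpperDoubling

variable {ω : ℝ → ℝ}

lemma isReproducingKernelAt_kernelFun (hω : ω ∈ UpperDoubling) {z : ℂ}
    (hz : z ∈ Metric.ball (0 : ℂ) 1) :
    IsReproducingKernelAt ω z fun ζ => kernelFun ω (conj z * ζ) := by
  have h := hω.1
  have hfin := h.isFiniteMeasure_weightedArea
  have hzr : ‖z‖ ∈ Ico (0 : ℝ) 1 := ⟨norm_nonneg z, mem_ball_zero_iff.1 hz⟩
  have hS := summable_kernelCoeff hω hzr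
  have hterm : ∀ n : ℕ, ∀ ζ ∈ Metric.ball (0 : ℂ) 1,
      ‖(kernelCoeff ω n : ℂ) * (conj z * ζ) ^ n‖ ≤ kernelCoeff ω n * ‖z‖ ^ n := fun n ζ hζ => by
    rw [norm_mul, norm_pow, norm_mul, RCLike.norm_conj, Complex.norm_real,
      Real.norm_of_nonneg (h.kernelCoeff_pos n).le]
    have := (h.kernelCoeff_pos n).le
    gcongr
    exact mul_le_of_le_one_right (norm_nonneg z) (mem_ball_zero_iff.1 hζ).le
  refine ⟨h.mem_bergmanSpace_of_bound ?_ fun ζ hζ => tsum_of_norm_bounded hS.hasSum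
    fun n => hterm n ζ hζ, ?_⟩
  · exact Complex.differentiableOn_tsum_of_summable_norm hS (fun n => by fun_prop)
      Metric.isOpen_ball hterm
  rintro f ⟨hd, hL⟩
  have hi : Integrable f (weightedArea ω) := hL.integrable one_le_two
  obtain ⟨c, hc, hcint⟩ := h.exists_hasSum_and_integral_eq hd hi
  set F : ℕ → ℂ → ℂ := fun n ζ => ((kernelCoeff ω n : ℂ) * z ^ n) * (f ζ * conj ζ ^ n) with hF
  have hFn : ∀ n, ∀ᵐ ζ ∂(weightedArea ω), ‖F n ζ‖ ≤ kernelCoeff ω n * ‖z‖ ^ n * ‖f ζ‖ := fun n => by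
    filter_upwards [ae_weightedArea_mem_ball] with ζ hζ
    rw [hF]
    simp only [norm_mul, norm_pow, RCLike.norm_conj, Complex.norm_real,
      Real.norm_of_nonneg (h.kernelCoeff_pos n).le]
    have h1 := (h.kernelCoeff_pos n).le
    refine mul_le_mul_of_nonneg_left ?_ (by positivity)
    exact mul_le_of_le_one_right (norm_nonneg _)
      (pow_le_one₀ (norm_nonneg _) (mem_ball_zero_iff.1 hζ).le)
  have hFi : ∀ n, Integrable (F n) (weightedArea ω) := fun n =>
    (hi.norm.const_mul _).mono' (((hi.aestronglyMeasurable.mul (by fun_prop)).const_mul _)) (hFn n)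
  have hsum := hasSum_integral_of_summable_integral_norm hFi (by
    refine Summable.of_nonneg_of_le (fun n => integral_nonneg fun ζ => norm_nonneg _) (fun n => ?_)
      (hS.mul_right (∫ ζ, ‖f ζ‖ ∂(weightedArea ω)))
    rw [← integral_const_mul]
    exact integral_mono_ae (hFi n).norm (hi.norm.const_mul _) (hFn n))
  have hval : ∀ n, ∫ ζ, F n ζ ∂(weightedArea ω) = c n * z ^ n := fun n => by
    rw [hF, integral_const_mul, hcint n, kernelCoeff]
    have : ((2 * moment ω (2 * n + 1) : ℝ) : ℂ) ≠ 0 := by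
      have := h.moment_pos (2 * n + 1)
      exact_mod_cast (by positivity : (2 * moment ω (2 * n + 1) : ℝ) ≠ 0)
    rw [Complex.ofReal_inv]
    field_simp
  simp only [hval] at hsum
  rw [(hc z hz).unique hsum]
  refine integral_congr_ae ?_
  filter_upwards [ae_weightedArea_mem_ball] with ζ hζ
  rw [kernelFun, Complex.conj_tsum, ← tsum_mul_left]
  refine tsum_congr fun n => ?_
  simp only [hF, map_mul, map_pow, Complex.conj_ofReal, Complex.conj_conj]
  ring

/-- Uniqueness of the reproducing kernel: testing the reproducing property on `ζ ^ n` determines the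
Taylor coefficients. -/
lemma eq_kernelFun_of_isReproducingKernelAt (hω : ω ∈ UpperDoubling) {z : ℂ} {K : ℂ → ℂ}
    (hK : IsReproducingKernelAt ω z K) {ζ : ℂ} (hζ : ζ ∈ Metric.ball (0 : ℂ) 1) :
    K ζ = kernelFun ω (conj z * ζ) := by
  have h := hω.1
  have hfin := h.isFiniteMeasure_weightedArea
  obtain ⟨⟨hd, hL⟩, hrep⟩ := hK
  obtain ⟨c, hc, hcint⟩ := h.exists_hasSum_and_integral_eq hd (hL.integrable one_le_two)
  have hcn : ∀ n, c n = kernelCoeff ω n * conj z ^ n := fun n => by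
    have h1 := hrep (fun ζ => ζ ^ n) (h.mem_bergmanSpace_of_bound (by fun_prop) (M := 1) fun ζ hζ => by
      rw [norm_pow]
      exact pow_le_one₀ (norm_nonneg _) (mem_ball_zero_iff.1 hζ).le)
    have h2 : ∫ ζ, ζ ^ n * conj (K ζ) ∂(weightedArea ω) =
        conj (∫ ζ, K ζ * conj ζ ^ n ∂(weightedArea ω)) := by
      rw [← integral_conj]
      congr 1
      funext ζ
      simp [mul_comm]
    rw [h2, hcint n] at h1
    have h3 := congrArg conj h1
    rw [Complex.conj_conj, map_pow] at h3
    have : ((2 * moment ω (2 * n + 1) : ℝ) : ℂ) ≠ 0 := by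
      have := h.moment_pos (2 * n + 1)
      exact_mod_cast (by positivity : (2 * moment ω (2 * n + 1) : ℝ) ≠ 0)
    rw [h3, kernelCoeff, Complex.ofReal_inv]
    field_simp
  rw [← (hc ζ hζ).tsum_eq, kernelFun]
  refine tsum_congr fun n => ?_
  rw [hcn, mul_pow]
  ring

lemma bergmanKernel_eq_kernelFun (hω : ω ∈ UpperDoubling) {z ζ : ℂ}
    (hz : z ∈ Metric.ball (0 : ℂ) 1) (hζ : ζ ∈ Metric.ball (0 : ℂ) 1) :
    bergmanKernel ω z ζ = kernelFun ω (conj z * ζ) :=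
  eq_kernelFun_of_isReproducingKernelAt hω
    (Classical.epsilon_spec ⟨_, isReproducingKernelAt_kernelFun hω hz⟩) hζ

end UpperDoubling

/-! ### The size function of the modified kernel -/

/-- The size function `(x^N / (x ω̂(1 - x)))^p`: up to a constant it is an upper bound for
`|(1 - w)^N B(w)|^p` when `|1 - w|` is comparable to `x`. -/
def kernelSize (p : ℝ) (N : ℕ) (ω : ℝ → ℝ) (x : ℝ) : ℝ := (x ^ N / (x * tailAt ω x)) ^ p

/-- The weight `t ↦ ω̂(t)^(-p) (1 - t)^(-p (1 - N))` on `[0, 1)`, extended by zero. -/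
def kernelDensity (p : ℝ) (N : ℕ) (ω : ℝ → ℝ) : ℝ → ℝ≥0∞ :=
  (Ico 0 1).indicator fun t => ENNReal.ofReal (kernelSize p N ω (1 - t))

variable {p : ℝ} {N : ℕ} {ω ν : ℝ → ℝ}

namespace IsRadialWeight

lemma kernelSize_pos (h : IsRadialWeight ω) {x : ℝ} (hx : 0 < x) : 0 < kernelSize p N ω x := by
  have := h.tailAt_pos hx
  unfold kernelSize
  positivity

lemma continuousOn_tail (h : IsRadialWeight ω) : ContinuousOn (tail ω) (Icc 0 1) := by
  have := intervalIntegral.continuousOn_primitive_interval_left (μ := volume) (f := ω) (a := 0) (b := 1)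
    (by rw [uIcc_of_le zero_le_one, integrableOn_Icc_iff_integrableOn_Ico]; exact h.integrableOn)
  rwa [uIcc_of_le zero_le_one] at this

lemma continuousOn_kernelSize_one_sub (h : IsRadialWeight ω) :
    ContinuousOn (fun t => kernelSize p N ω (1 - t)) (Ico 0 1) := by
  have h1 : ContinuousOn (fun t => ((1 - t) ^ N / ((1 - t) * tail ω t)) ^ p) (Ico 0 1) := by
    have hT : ContinuousOn (tail ω) (Ico 0 1) := h.continuousOn_tail.mono Ico_subset_Icc_self
    have hpos : ∀ t ∈ Ico (0 : ℝ) 1, 0 < (1 - t) * tail ω t := fun t ht =>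
      mul_pos (by linarith [ht.2]) (h.tail_pos t ht)
    refine ContinuousOn.rpow_const (ContinuousOn.div (by fun_prop) (by fun_prop)
      fun t ht => (hpos t ht).ne') fun t ht => Or.inl ?_
    have := hpos t ht
    have h1t : 0 < 1 - t := by linarith [ht.2]
    positivity
  refine h1.congr fun t ht => ?_
  rw [kernelSize, tailAt_of_le (by linarith [ht.1]), sub_sub_cancel]

lemma measurable_kernelDensity (h : IsRadialWeight ω) : Measurable (kernelDensity p N ω) := by
  classical
  rw [kernelDensity, ← piecewise_eq_indicator]
  exact ContinuousOn.measurable_piecewise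
    (ENNReal.continuous_ofReal.comp_continuousOn h.continuousOn_kernelSize_one_sub)
    continuousOn_const measurableSet_Ico

/-- The bound of the theorem as a lower Lebesgue integral. -/
lemma ofReal_kernelBound (h : IsRadialWeight ω) (hν : IsRadialWeight ν) {x : ℝ}
    (hx : x ∈ Ico (0 : ℝ) 1) :
    ENNReal.ofReal (kernelBound p N ω ν x) =
      (∫⁻ t in Ioc 0 x, ENNReal.ofReal (tail ν t) * kernelDensity p N ω t) + 1 := by
  have hsub : Icc 0 x ⊆ Ico (0 : ℝ) 1 := fun t ht => ⟨ht.1, ht.2.trans_lt hx.2⟩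
  have hcont : ContinuousOn (fun t => tail ν t * kernelSize p N ω (1 - t)) (Icc 0 x) :=
    (hν.continuousOn_tail.mono (hsub.trans Ico_subset_Icc_self)).mul
      (h.continuousOn_kernelSize_one_sub.mono hsub)
  have hnn : ∀ t ∈ Icc 0 x, 0 ≤ tail ν t * kernelSize p N ω (1 - t) := fun t ht =>
    mul_nonneg (hν.tail_nonneg ⟨ht.1, (hsub ht).2.le⟩)
      (h.kernelSize_pos (by linarith [(hsub ht).2])).le
  have e : ∀ t ∈ Icc 0 x, tail ν t / (tail ω t ^ p * (1 - t) ^ (p * (1 - (N : ℝ)))) =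
      tail ν t * kernelSize p N ω (1 - t) := fun t ht => by
    have h1t : 0 < 1 - t := by linarith [(hsub ht).2]
    have hT := h.tail_pos t (hsub ht)
    rw [kernelSize, tailAt_of_le (by linarith [ht.1]), sub_sub_cancel, div_eq_mul_inv]
    congr 1
    rw [Real.div_rpow (by positivity) (by positivity), Real.mul_rpow h1t.le hT.le,
      ← Real.rpow_natCast_mul h1t.le, mul_sub, mul_one, Real.rpow_sub h1t, mul_comm (N : ℝ) p]
    have := Real.rpow_pos_of_pos h1t (p * N)
    have := Real.rpow_pos_of_pos h1t p
    have := Real.rpow_pos_of_pos hT p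
    field_simp
  have hint : kernelBound p N ω ν x = (∫ t in Ioc 0 x, tail ν t * kernelSize p N ω (1 - t)) + 1 := by
    rw [kernelBound, intervalIntegral.integral_of_le hx.1]
    congr 1
    exact setIntegral_congr_fun measurableSet_Ioc fun t ht => e t (Ioc_subset_Icc_self ht)
  have hi : IntegrableOn (fun t => tail ν t * kernelSize p N ω (1 - t)) (Ioc 0 x) :=
    hcont.integrableOn_Icc.mono_set Ioc_subset_Icc_self
  have hae : ∀ᵐ t ∂(volume.restrict (Ioc 0 x)), 0 ≤ tail ν t * kernelSize p N ω (1 - t) :=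
    (ae_restrict_iff' measurableSet_Ioc).2 (Eventually.of_forall fun t ht =>
      hnn t (Ioc_subset_Icc_self ht))
  rw [hint, ENNReal.ofReal_add (integral_nonneg_of_ae hae) zero_le_one, ENNReal.ofReal_one,
    ofReal_integral_eq_lintegral_ofReal hi hae]
  congr 1
  refine setLIntegral_congr_fun measurableSet_Ioc fun t ht => ?_
  have ht' := Ioc_subset_Icc_self ht
  rw [kernelDensity, indicator_of_mem (hsub ht'),
    ENNReal.ofReal_mul (hν.tail_nonneg ⟨ht'.1, (hsub ht').2.le⟩)]

end IsRadialWeight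

namespace UpperDoubling

/-- The size function varies by at most a constant factor between comparable distances. -/
lemma exists_kernelSize_le (hω : ω ∈ UpperDoubling) (hp : 0 ≤ p) (N : ℕ) {A : ℝ} (hA : 0 < A) :
    ∃ C : ℝ, 1 ≤ C ∧ ∀ x y : ℝ, 0 < x → 0 < y → x ≤ A * y → y ≤ A * x →
      kernelSize p N ω x ≤ C * kernelSize p N ω y := by
  have h := hω.1
  obtain ⟨C, hC, hT⟩ := exists_tailAt_mul_le hω A
  refine ⟨(max 1 (A ^ N * A * C)) ^ p, Real.one_le_rpow (le_max_left _ _) hp,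
    fun x y hx hy hxy hyx => ?_⟩
  have hTx := h.tailAt_pos hx
  have hTy := h.tailAt_pos hy
  rw [kernelSize, kernelSize, ← Real.mul_rpow (by positivity) (by positivity)]
  refine Real.rpow_le_rpow (by positivity) ?_ hp
  have h1 : x ^ N ≤ A ^ N * y ^ N := by rw [← mul_pow]; gcongr
  have h2 : y * tailAt ω y ≤ A * C * (x * tailAt ω x) := by
    calc y * tailAt ω y ≤ (A * x) * (C * tailAt ω x) := by
          gcongr
          exact hT y x hy hx hyx
      _ = _ := by ring
  calc x ^ N / (x * tailAt ω x) ≤ A ^ N * A * C * (y ^ N / (y * tailAt ω y)) := by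
        rw [mul_div_assoc', div_le_div_iff₀ (by positivity) (by positivity)]
        calc x ^ N * (y * tailAt ω y) ≤ (A ^ N * y ^ N) * (A * C * (x * tailAt ω x)) := by gcongr
          _ = _ := by ring
    _ ≤ _ := by
        gcongr
        exact le_max_right _ _

end UpperDoubling

/-! ### Integral means over circles -/

lemma lintegral_Ioo_symm_le (g : ℝ → ℝ≥0∞) (a : ℝ) :
    ∫⁻ θ in Ioo (-a) a, g |θ| ≤ 2 * ∫⁻ θ in Icc 0 a, g θ := by
  have hsub : Ioo (-a) a ⊆ Icc 0 a ∪ (fun θ : ℝ => -θ) ⁻¹' Icc 0 a := fun θ hθ => by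
    rcases le_total 0 θ with h0 | h0
    · exact Or.inl ⟨h0, hθ.2.le⟩
    · exact Or.inr ⟨by simpa using h0, by simpa using neg_le.1 hθ.1.le⟩
  refine (lintegral_mono_set hsub).trans ((lintegral_union_le _ _ _).trans ?_)
  rw [two_mul]
  refine add_le_add (le_of_eq ?_) (le_of_eq ?_)
  · exact setLIntegral_congr_fun measurableSet_Icc fun θ hθ => by simp only [abs_of_nonneg hθ.1]
  · refine Eq.trans ?_
      ((Measure.measurePreserving_neg (volume : Measure ℝ)).setLIntegral_comp_preimage_emb
        (MeasurableEquiv.neg ℝ).measurableEmbedding g (Icc 0 a))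
    refine setLIntegral_congr_fun (measurable_neg (measurableSet_Icc (a := 0) (b := a)))
      fun θ hθ => ?_
    have h0 : 0 ≤ -θ := hθ.1
    simp only [abs_of_nonpos (neg_nonneg.1 h0)]

lemma norm_one_sub_polarPoint_le {ρ : ℝ} (hρ : ρ ∈ Ico (0 : ℝ) 1) (θ : ℝ) :
    ‖1 - polarPoint (ρ, θ)‖ ≤ 2 * max (1 - ρ) |θ| := by
  have h1 : 1 - polarPoint (ρ, θ) =
      ((1 - ρ : ℝ) : ℂ) + -((ρ : ℂ) * (Complex.exp (Complex.I * θ) - 1)) := by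
    simp only [polarPoint]
    rw [mul_comm Complex.I]
    push_cast
    ring
  rw [h1]
  refine (norm_add_le _ _).trans ?_
  rw [norm_neg, norm_mul, Complex.norm_real, Complex.norm_real,
    Real.norm_of_nonneg (by linarith [hρ.2]), Real.norm_of_nonneg hρ.1]
  have h2 := Real.norm_exp_I_mul_ofReal_sub_one_le (x := θ)
  rw [Real.norm_eq_abs] at h2
  have h3 : ρ * ‖Complex.exp (Complex.I * θ) - 1‖ ≤ 1 * |θ| :=
    mul_le_mul hρ.2.le h2 (norm_nonneg _) zero_le_one
  linarith [le_max_left (1 - ρ) |θ|, le_max_right (1 - ρ) |θ|]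

lemma one_sub_le_norm_one_sub_polarPoint {ρ : ℝ} (hρ : 0 ≤ ρ) (θ : ℝ) :
    1 - ρ ≤ ‖1 - polarPoint (ρ, θ)‖ := by
  have := norm_sub_norm_le (1 : ℂ) (polarPoint (ρ, θ))
  rwa [norm_one, norm_polarPoint hρ] at this

lemma max_le_norm_one_sub_polarPoint {ρ : ℝ} (hρ : ρ ∈ Ico (0 : ℝ) 1) {θ : ℝ}
    (hθ : θ ∈ Ioo (-Real.pi) Real.pi) :
    max (1 - ρ) |θ| ≤ 4 * ‖1 - polarPoint (ρ, θ)‖ := by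
  have h1 := one_sub_le_norm_one_sub_polarPoint hρ.1 θ
  refine max_le (by linarith [norm_nonneg (1 - polarPoint (ρ, θ))]) ?_
  -- `2 |θ| / π ≤ |e^{iθ} - 1| ≤ (1 - ρ) + |1 - ρ e^{iθ}|`
  have h2 : ‖Complex.exp (Complex.I * θ) - 1‖ ≤ 2 * ‖1 - polarPoint (ρ, θ)‖ := by
    have e : Complex.exp (Complex.I * θ) - 1 =
        ((1 - ρ : ℝ) : ℂ) * Complex.exp (θ * Complex.I) + -(1 - polarPoint (ρ, θ)) := by
      simp only [polarPoint]
      rw [mul_comm Complex.I]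
      push_cast
      ring
    rw [e]
    refine (norm_add_le _ _).trans ?_
    rw [norm_neg, norm_mul, Complex.norm_exp_ofReal_mul_I, mul_one, Complex.norm_real,
      Real.norm_of_nonneg (by linarith [hρ.2])]
    linarith
  have h3 : |θ| ≤ Real.pi / 2 * ‖Complex.exp (Complex.I * θ) - 1‖ := by
    have hθ' : |θ| < Real.pi := abs_lt.2 hθ
    rw [Complex.norm_exp_I_mul_ofReal_sub_one, Real.norm_eq_abs, abs_mul, abs_two]
    have h4 := Real.mul_le_sin (x := |θ| / 2) (by positivity) (by linarith)
    have h5 : Real.sin (|θ| / 2) ≤ |Real.sin (θ / 2)| := by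
      rcases abs_cases θ with ⟨e, _⟩ | ⟨e, _⟩
      · rw [e]; exact le_abs_self _
      · rw [e, neg_div, Real.sin_neg]; exact neg_le_abs _
    have h6 := h4.trans h5
    have hpi := Real.pi_pos
    calc |θ| = Real.pi / 2 * (2 * (2 / Real.pi * (|θ| / 2))) := by field_simp
      _ ≤ _ := by gcongr
  have hpi := Real.pi_lt_four
  have hpi0 := Real.pi_pos
  nlinarith [norm_nonneg (1 - polarPoint (ρ, θ))]

namespace UpperDoubling

/-- The size function at the distance `1 - ρ`, times `1 - ρ`, is controlled by its integral, because the
distances between `1 - ρ` and `2 (1 - ρ)` contribute that much. -/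
lemma exists_kernelSize_mul_le (hω : ω ∈ UpperDoubling) (hp : 0 ≤ p) (N : ℕ) :
    ∃ C : ℝ≥0∞, C ≠ ∞ ∧ ∀ ρ ∈ Ico (0 : ℝ) 1,
      ENNReal.ofReal (kernelSize p N ω (1 - ρ) * (1 - ρ)) ≤
        C * ((∫⁻ t in Ioc 0 ρ, kernelDensity p N ω t) + 1) := by
  have h := hω.1
  obtain ⟨C, hC, hS⟩ := exists_kernelSize_le hω hp N (A := 2) (by norm_num)
  have hC0 : 0 ≤ C := by linarith
  have h1 := (h.kernelSize_pos (p := p) (N := N) one_pos).le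
  refine ⟨ENNReal.ofReal C + ENNReal.ofReal (C * kernelSize p N ω 1),
    ENNReal.add_ne_top.2 ⟨ENNReal.ofReal_ne_top, ENNReal.ofReal_ne_top⟩, fun ρ hρ => ?_⟩
  have hx : 0 < 1 - ρ := by linarith [hρ.2]
  have hpos := (h.kernelSize_pos (p := p) (N := N) hx).le
  rcases le_total ρ (1 / 2) with hle | hge
  · have h2 : kernelSize p N ω (1 - ρ) * (1 - ρ) ≤ C * kernelSize p N ω 1 := by
      have := hS (1 - ρ) 1 hx one_pos (by linarith [hρ.1]) (by linarith)
      nlinarith [hρ.1]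
    calc ENNReal.ofReal (kernelSize p N ω (1 - ρ) * (1 - ρ))
        ≤ ENNReal.ofReal (C * kernelSize p N ω 1) * 1 := by
          rw [mul_one]; exact ENNReal.ofReal_le_ofReal h2
      _ ≤ _ := mul_le_mul' le_add_self le_add_self
  · have hsub : Ioc (1 - 2 * (1 - ρ)) ρ ⊆ Ioc 0 ρ := Ioc_subset_Ioc_left (by linarith)
    have h3 : ENNReal.ofReal (kernelSize p N ω (1 - ρ) * (1 - ρ)) ≤
        ∫⁻ t in Ioc (1 - 2 * (1 - ρ)) ρ, ENNReal.ofReal C * kernelDensity p N ω t := by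
      calc ENNReal.ofReal (kernelSize p N ω (1 - ρ) * (1 - ρ))
          = ∫⁻ _ in Ioc (1 - 2 * (1 - ρ)) ρ, ENNReal.ofReal (kernelSize p N ω (1 - ρ)) := by
            rw [setLIntegral_const, Real.volume_Ioc, ← ENNReal.ofReal_mul hpos]
            congr 2
            ring
        _ ≤ _ := by
            refine setLIntegral_mono' measurableSet_Ioc fun t ht => ?_
            have ht0 : t ∈ Ico (0 : ℝ) 1 := ⟨(hsub ht).1.le, ht.2.trans_lt hρ.2⟩
            rw [kernelDensity, indicator_of_mem ht0, ← ENNReal.ofReal_mul hC0]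
            exact ENNReal.ofReal_le_ofReal
              (hS _ _ hx (by linarith [ht0.2]) (by linarith [ht.2]) (by linarith [ht.1]))
    rw [lintegral_const_mul' _ _ ENNReal.ofReal_ne_top] at h3
    refine h3.trans (mul_le_mul' le_self_add ?_)
    exact (lintegral_mono_set hsub).trans le_self_add

/-- Upper bound for integral means: `|1 - ρ e^{iθ}|` is comparable to `max (1 - ρ) |θ|`. -/
lemma exists_lintegral_circle_le (hω : ω ∈ UpperDoubling) (hp : 0 ≤ p) (N : ℕ) :
    ∃ C : ℝ≥0∞, C ≠ ∞ ∧ ∀ ρ ∈ Ico (0 : ℝ) 1,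
      ∫⁻ θ in Ioo (-Real.pi) Real.pi, ENNReal.ofReal (kernelSize p N ω ‖1 - polarPoint (ρ, θ)‖) ≤
        C * ((∫⁻ t in Ioc 0 ρ, kernelDensity p N ω t) + 1) := by
  have h := hω.1
  obtain ⟨C, hC, hS⟩ := exists_kernelSize_le hω hp N (A := 4) (by norm_num)
  obtain ⟨K, hK, hKS⟩ := exists_kernelSize_mul_le hω hp N
  have hC0 : 0 ≤ C := by linarith
  set B : ℝ≥0∞ := ENNReal.ofReal (C * kernelSize p N ω 1) * ENNReal.ofReal Real.pi with hB
  have hBtop : B ≠ ∞ := ENNReal.mul_ne_top ENNReal.ofReal_ne_top ENNReal.ofReal_ne_top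
  refine ⟨ENNReal.ofReal C * (2 * (K + 1 + B)), ?_, fun ρ hρ => ?_⟩
  · exact ENNReal.mul_ne_top ENNReal.ofReal_ne_top (ENNReal.mul_ne_top (by simp)
      (ENNReal.add_ne_top.2 ⟨ENNReal.add_ne_top.2 ⟨hK, by simp⟩, hBtop⟩))
  have hx : 0 < 1 - ρ := by linarith [hρ.2]
  set J : ℝ≥0∞ := ∫⁻ t in Ioc 0 ρ, kernelDensity p N ω t with hJ
  set g : ℝ → ℝ≥0∞ := fun y => ENNReal.ofReal (kernelSize p N ω (max (1 - ρ) y)) with hg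
  have hstep : ∫⁻ θ in Ioo (-Real.pi) Real.pi,
        ENNReal.ofReal (kernelSize p N ω ‖1 - polarPoint (ρ, θ)‖) ≤
      ENNReal.ofReal C * ∫⁻ θ in Ioo (-Real.pi) Real.pi, g |θ| := by
    rw [← lintegral_const_mul' _ _ ENNReal.ofReal_ne_top]
    refine setLIntegral_mono' measurableSet_Ioo fun θ hθ => ?_
    rw [hg, ← ENNReal.ofReal_mul hC0]
    have h1 := one_sub_le_norm_one_sub_polarPoint hρ.1 θ
    have h2 : 0 < max (1 - ρ) |θ| := lt_max_of_lt_left hx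
    exact ENNReal.ofReal_le_ofReal (hS _ _ (by linarith) h2
      (by linarith [norm_one_sub_polarPoint_le hρ θ]) (max_le_norm_one_sub_polarPoint hρ hθ))
  have hhalf : ∫⁻ θ in Icc 0 Real.pi, g θ ≤ K * (J + 1) + J + B := by
    have hsub : Icc 0 Real.pi ⊆ (Icc 0 (1 - ρ) ∪ Ico (1 - ρ) 1) ∪ Icc 1 Real.pi := fun θ hθ => by
      rcases le_total θ (1 - ρ) with h1 | h1
      · exact Or.inl (Or.inl ⟨hθ.1, h1⟩)
      · rcases lt_or_ge θ 1 with h2 | h2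
        · exact Or.inl (Or.inr ⟨h1, h2⟩)
        · exact Or.inr ⟨h2, hθ.2⟩
    refine (lintegral_mono_set hsub).trans ((lintegral_union_le _ _ _).trans ?_)
    refine add_le_add ((lintegral_union_le _ _ _).trans (add_le_add ?_ ?_)) ?_
    · refine le_trans (le_of_eq ?_) (hKS ρ hρ)
      rw [setLIntegral_congr_fun (g := fun _ => ENNReal.ofReal (kernelSize p N ω (1 - ρ)))
        measurableSet_Icc fun θ hθ => by simp only [hg, max_eq_left hθ.2], setLIntegral_const,
        Real.volume_Icc, ← ENNReal.ofReal_mul (h.kernelSize_pos hx).le, sub_zero]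
    · rw [← (Measure.measurePreserving_sub_left (volume : Measure ℝ) 1).setLIntegral_comp_preimage_emb
        (MeasurableEquiv.subLeft (1 : ℝ)).measurableEmbedding]
      have hpre : (fun t : ℝ => 1 - t) ⁻¹' Ico (1 - ρ) 1 = Ioc 0 ρ := by
        ext t
        simp only [mem_preimage, mem_Ico, mem_Ioc]
        constructor <;> rintro ⟨h1, h2⟩ <;> constructor <;> linarith
      rw [hpre, hJ]
      refine setLIntegral_mono' measurableSet_Ioc fun t ht => ?_
      have ht0 : t ∈ Ico (0 : ℝ) 1 := ⟨ht.1.le, ht.2.trans_lt hρ.2⟩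
      rw [kernelDensity, indicator_of_mem ht0]
      simp only [hg, max_eq_right (show 1 - ρ ≤ 1 - t by linarith [ht.2])]
      exact le_rfl
    · have hle : ∫⁻ θ in Icc 1 Real.pi, g θ ≤
          ∫⁻ _ in Icc 1 Real.pi, ENNReal.ofReal (C * kernelSize p N ω 1) := by
        refine setLIntegral_mono' measurableSet_Icc fun θ hθ => ENNReal.ofReal_le_ofReal ?_
        rw [max_eq_right (by linarith [hθ.1, hρ.1])]
        exact hS _ _ (by linarith [hθ.1]) one_pos (by linarith [hθ.2, Real.pi_lt_four])
          (by linarith [hθ.1])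
      refine hle.trans ?_
      rw [setLIntegral_const, Real.volume_Icc, hB]
      gcongr
      linarith
  calc _ ≤ ENNReal.ofReal C * ∫⁻ θ in Ioo (-Real.pi) Real.pi, g |θ| := hstep
    _ ≤ ENNReal.ofReal C * (2 * (K * (J + 1) + J + B)) := by
        gcongr
        exact (lintegral_Ioo_symm_le g Real.pi).trans (by gcongr)
    _ ≤ ENNReal.ofReal C * (2 * (K * (J + 1) + 1 * (J + 1) + B * (J + 1))) := by
        gcongr
        · rw [one_mul]; exact le_self_add
        · exact le_mul_of_one_le_right' le_add_self
    _ = _ := by ring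

end UpperDoubling

/-! ### Reduction to integrals over circles -/

lemma measurePreserving_mul_weightedArea {u : ℂ} (hu : ‖u‖ = 1) (ν : ℝ → ℝ) :
    MeasurePreserving (fun ζ => u * ζ) (weightedArea ν) (weightedArea ν) := by
  set U : Circle := ⟨u, by simpa [Submonoid.unitSphere] using hu⟩ with hU
  have hrot : (⇑(rotation U) : ℂ → ℂ) = fun ζ => u * ζ := by
    funext ζ; rw [rotation_apply]
  have hemb : MeasurableEmbedding (fun ζ : ℂ => u * ζ) := by
    rw [← hrot]
    exact (rotation U).toHomeomorph.measurableEmbedding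
  have hvol : MeasurePreserving (fun ζ : ℂ => u * ζ) volume volume := by
    rw [← hrot]
    exact (rotation U).measurePreserving
  have hnorm : ∀ ζ : ℂ, ‖u * ζ‖ = ‖ζ‖ := fun ζ => by rw [norm_mul, hu, one_mul]
  have hpre : (fun ζ : ℂ => u * ζ) ⁻¹' Metric.ball 0 1 = Metric.ball 0 1 := by
    ext ζ
    rw [mem_preimage, mem_ball_zero_iff, mem_ball_zero_iff, hnorm]
  have hdisk : MeasurePreserving (fun ζ : ℂ => u * ζ) diskArea diskArea := by
    have := hvol.restrict_preimage_emb hemb (Metric.ball 0 1)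
    rw [hpre] at this
    exact this.smul_measure _
  refine ⟨hemb.measurable, Measure.ext fun A hA => ?_⟩
  rw [Measure.map_apply hemb.measurable hA, weightedArea,
    withDensity_apply _ (hemb.measurable hA), withDensity_apply _ hA]
  simpa only [hnorm] using
    hdisk.setLIntegral_comp_preimage_emb hemb (fun ζ => ENNReal.ofReal (ν ‖ζ‖)) A

lemma polarPoint_mul (x s θ : ℝ) : polarPoint (x * s, θ) = x * polarPoint (s, θ) := by
  simp only [polarPoint]
  push_cast
  ring

/-- The integral of the theorem in polar coordinates, after a rotation that makes `z` real. -/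
lemma UpperDoubling.modifiedKernelIntegral_eq (hω : ω ∈ UpperDoubling) (hν : IsRadialWeight ν) {z : ℂ}
    (hz : z ∈ Metric.ball (0 : ℂ) 1) :
    modifiedKernelIntegral p N ω ν z = ∫⁻ s, ENNReal.ofReal (s / Real.pi) *
      (∫⁻ θ in Ioo (-Real.pi) Real.pi, ‖(1 - polarPoint (‖z‖ * s, θ)) ^ N *
        kernelFun ω (polarPoint (‖z‖ * s, θ))‖ₑ ^ p) ∂(profileMeasure ν) := by
  obtain ⟨u, hu, hzu⟩ : ∃ u : ℂ, ‖u‖ = 1 ∧ conj z = ‖z‖ * u := by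
    rcases eq_or_ne z 0 with rfl | hz0
    · exact ⟨1, by simp, by simp⟩
    · have : (‖z‖ : ℂ) ≠ 0 := by simpa using hz0
      refine ⟨conj z / ‖z‖, ?_, by field_simp⟩
      rw [norm_div, RCLike.norm_conj, Complex.norm_real, norm_norm, div_self (by simpa using hz0)]
  set x := ‖z‖ with hx
  have hx0 : 0 ≤ x := norm_nonneg z
  have hx1 : x < 1 := mem_ball_zero_iff.1 hz
  have hxball : (x : ℂ) ∈ Metric.ball (0 : ℂ) 1 := by
    rw [mem_ball_zero_iff, Complex.norm_real, Real.norm_of_nonneg hx0]; exact hx1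
  set F : ℂ → ℝ≥0∞ := (Metric.ball (0 : ℂ) 1).indicator fun ζ =>
    ‖(1 - x * ζ) ^ N * kernelFun ω (x * ζ)‖ₑ ^ p with hF
  have hFm : Measurable F := by
    have hd := (isReproducingKernelAt_kernelFun hω hxball).1.1.continuousOn
    simp only [Complex.conj_ofReal] at hd
    have hcont : ContinuousOn (fun ζ : ℂ => ‖(1 - x * ζ) ^ N * kernelFun ω (x * ζ)‖)
        (Metric.ball 0 1) :=
      (ContinuousOn.mul (by fun_prop) hd).norm
    have hm : Measurable ((Metric.ball (0 : ℂ) 1).indicator fun ζ : ℂ =>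
        ‖(1 - x * ζ) ^ N * kernelFun ω (x * ζ)‖) := by
      classical
      rw [← piecewise_eq_indicator]
      exact hcont.measurable_piecewise continuousOn_const Metric.isOpen_ball.measurableSet
    have e : F = (Metric.ball (0 : ℂ) 1).indicator fun ζ => ENNReal.ofReal
        ((Metric.ball (0 : ℂ) 1).indicator
          (fun ζ : ℂ => ‖(1 - x * ζ) ^ N * kernelFun ω (x * ζ)‖) ζ) ^ p := by
      refine indicator_congr fun ζ hζ => ?_
      rw [indicator_of_mem hζ, ofReal_norm]
    rw [e]
    exact (hm.ennreal_ofReal.pow_const p).indicator Metric.isOpen_ball.measurableSet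
  have h1 : modifiedKernelIntegral p N ω ν z = ∫⁻ ζ, F (u * ζ) ∂(weightedArea ν) := by
    refine lintegral_congr_ae ?_
    filter_upwards [ae_weightedArea_mem_ball] with ζ hζ
    have huζ : u * ζ ∈ Metric.ball (0 : ℂ) 1 := by
      rw [mem_ball_zero_iff, norm_mul, hu, one_mul]; exact mem_ball_zero_iff.1 hζ
    rw [hF, indicator_of_mem huζ, bergmanKernel_eq_kernelFun hω hz hζ, hzu, mul_assoc]
  rw [h1, (measurePreserving_mul_weightedArea hu ν).lintegral_comp hFm, hν.lintegral_weightedArea hFm]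
  refine lintegral_congr_ae ?_
  filter_upwards [IsRadialWeight.ae_profileMeasure] with s hs
  congr 1
  refine lintegral_congr fun θ => ?_
  rw [hF, indicator_of_mem, polarPoint_mul]
  rw [mem_ball_zero_iff, norm_polarPoint hs.1]
  exact hs.2

/-! ### The upper estimate -/

lemma UpperDoubling.exists_enorm_rpow_le (hω : ω ∈ UpperDoubling) (hp : 0 ≤ p) (N : ℕ) :
    ∃ C : ℝ, 0 ≤ C ∧ ∀ w : ℂ, ‖w‖ < 1 →
      ‖(1 - w) ^ N * kernelFun ω w‖ₑ ^ p ≤ ENNReal.ofReal (C * kernelSize p N ω ‖1 - w‖) := by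
  obtain ⟨C, hC, hB⟩ := exists_norm_kernelFun_le hω
  refine ⟨C ^ p, by positivity, fun w hw => ?_⟩
  have hδ : 0 < ‖1 - w‖ := by
    rw [norm_pos_iff, sub_ne_zero]
    rintro rfl
    simp at hw
  have hT := hω.1.tailAt_pos hδ
  rw [← ofReal_norm, ENNReal.ofReal_rpow_of_nonneg (norm_nonneg _) hp, kernelSize,
    ← Real.mul_rpow hC.le (by positivity)]
  refine ENNReal.ofReal_le_ofReal (Real.rpow_le_rpow (norm_nonneg _) ?_ hp)
  rw [norm_mul, norm_pow]
  calc ‖1 - w‖ ^ N * ‖kernelFun ω w‖ ≤ ‖1 - w‖ ^ N * (C / (‖1 - w‖ * tailAt ω ‖1 - w‖)) := by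
        gcongr
        exact hB w hw
    _ = _ := by ring

/-- Integrating `∫_0^{xs} h` against a measure on `s` and exchanging the integrals bounds it by the
integral of `h` against the tail. -/
lemma IsRadialWeight.lintegral_lintegral_Ioc_le (hν : IsRadialWeight ν) {g : ℝ → ℝ≥0∞}
    (hg : Measurable g) {x : ℝ} (hx : x ∈ Ico (0 : ℝ) 1) :
    ∫⁻ s, (∫⁻ t in Ioc 0 (x * s), g t) ∂(profileMeasure ν) ≤
      ∫⁻ t in Ioc 0 x, ENNReal.ofReal (tail ν t) * g t := by
  have := hν.isFiniteMeasure
  have hmeas : Measurable (Function.uncurry fun s t : ℝ => (Ici t).indicator (fun _ => g t) s) := by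
    have e : (Function.uncurry fun s t : ℝ => (Ici t).indicator (fun _ => g t) s) =
        {q : ℝ × ℝ | q.2 ≤ q.1}.indicator fun q => g q.2 := by
      funext q
      simp only [Function.uncurry, indicator, mem_Ici]
      rfl
    rw [e]
    exact (hg.comp measurable_snd).indicator (measurableSet_le measurable_snd measurable_fst)
  calc ∫⁻ s, (∫⁻ t in Ioc 0 (x * s), g t) ∂(profileMeasure ν)
      ≤ ∫⁻ s, (∫⁻ t in Ioc 0 x, (Ici t).indicator (fun _ => g t) s) ∂(profileMeasure ν) := by
        refine lintegral_mono_ae ?_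
        filter_upwards [ae_profileMeasure] with s hs
        have h1 : x * s ≤ x := mul_le_of_le_one_right hx.1 hs.2.le
        have h2 : x * s ≤ s := mul_le_of_le_one_left hs.1 hx.2.le
        calc ∫⁻ t in Ioc 0 (x * s), g t
            = ∫⁻ t in Ioc 0 (x * s), (Ici t).indicator (fun _ => g t) s :=
              setLIntegral_congr_fun measurableSet_Ioc fun t ht =>
                (indicator_of_mem (show s ∈ Ici t from ht.2.trans h2) (fun _ => g t)).symm
          _ ≤ _ := lintegral_mono_set (Ioc_subset_Ioc_right h1)
    _ = ∫⁻ t in Ioc 0 x, (∫⁻ s, (Ici t).indicator (fun _ => g t) s ∂(profileMeasure ν)) :=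
        lintegral_lintegral_swap hmeas.aemeasurable
    _ = ∫⁻ t in Ioc 0 x, ENNReal.ofReal (tail ν t) * g t := by
        refine setLIntegral_congr_fun measurableSet_Ioc fun t ht => ?_
        rw [lintegral_indicator measurableSet_Ici, setLIntegral_const,
          hν.profileMeasure_Ici ⟨ht.1.le, ht.2.trans hx.2.le⟩, mul_comm]

theorem UpperDoubling.exists_modifiedKernelIntegral_le (hω : ω ∈ UpperDoubling)
    (hν : IsRadialWeight ν) (hp : 0 ≤ p) (N : ℕ) :
    ∃ C : ℝ, 0 < C ∧ ∀ z ∈ Metric.ball (0 : ℂ) 1,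
      modifiedKernelIntegral p N ω ν z ≤ ENNReal.ofReal (C * kernelBound p N ω ν ‖z‖) := by
  have h := hω.1
  have hfin := hν.isFiniteMeasure
  obtain ⟨C₁, hC₁, hB⟩ := exists_enorm_rpow_le hω hp N
  obtain ⟨C₂, hC₂, hI⟩ := exists_lintegral_circle_le hω hp N
  have hm : profileMeasure ν univ ≠ ∞ := measure_ne_top _ _
  set C : ℝ≥0∞ := ENNReal.ofReal C₁ * C₂ * (1 + profileMeasure ν univ) with hC
  have hCtop : C ≠ ∞ := ENNReal.mul_ne_top (ENNReal.mul_ne_top ENNReal.ofReal_ne_top hC₂)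
    (ENNReal.add_ne_top.2 ⟨ENNReal.one_ne_top, hm⟩)
  refine ⟨C.toReal + 1, by positivity, fun z hz => ?_⟩
  have hx : ‖z‖ ∈ Ico (0 : ℝ) 1 := ⟨norm_nonneg z, mem_ball_zero_iff.1 hz⟩
  rw [modifiedKernelIntegral_eq hω hν hz, ENNReal.ofReal_mul (by positivity),
    h.ofReal_kernelBound hν hx]
  set J : ℝ≥0∞ := ∫⁻ t in Ioc 0 ‖z‖, ENNReal.ofReal (tail ν t) * kernelDensity p N ω t with hJ
  have hinner : ∀ᵐ s ∂(profileMeasure ν), ENNReal.ofReal (s / Real.pi) *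
      (∫⁻ θ in Ioo (-Real.pi) Real.pi, ‖(1 - polarPoint (‖z‖ * s, θ)) ^ N *
        kernelFun ω (polarPoint (‖z‖ * s, θ))‖ₑ ^ p) ≤
      ENNReal.ofReal C₁ * C₂ * ((∫⁻ t in Ioc 0 (‖z‖ * s), kernelDensity p N ω t) + 1) := by
    filter_upwards [IsRadialWeight.ae_profileMeasure] with s hs
    have hρ : ‖z‖ * s ∈ Ico (0 : ℝ) 1 :=
      ⟨mul_nonneg hx.1 hs.1, mul_lt_one_of_nonneg_of_lt_one_left hx.1 hx.2 hs.2.le⟩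
    have h1 : ENNReal.ofReal (s / Real.pi) ≤ 1 := by
      rw [ENNReal.ofReal_le_one, div_le_one Real.pi_pos]
      linarith [hs.2, Real.pi_gt_three]
    refine (mul_le_of_le_one_left' h1).trans ?_
    rw [mul_assoc]
    refine le_trans ?_ (mul_le_mul_right (hI _ hρ) _)
    rw [← lintegral_const_mul' _ _ ENNReal.ofReal_ne_top]
    refine lintegral_mono fun θ => ?_
    rw [← ENNReal.ofReal_mul hC₁]
    exact hB _ (by rw [norm_polarPoint hρ.1]; exact hρ.2)
  calc _ ≤ ∫⁻ s, ENNReal.ofReal C₁ * C₂ *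
          ((∫⁻ t in Ioc 0 (‖z‖ * s), kernelDensity p N ω t) + 1) ∂(profileMeasure ν) :=
        lintegral_mono_ae hinner
    _ = ENNReal.ofReal C₁ * C₂ * ((∫⁻ s, (∫⁻ t in Ioc 0 (‖z‖ * s), kernelDensity p N ω t)
          ∂(profileMeasure ν)) + profileMeasure ν univ) := by
        rw [lintegral_const_mul' _ _ (ENNReal.mul_ne_top ENNReal.ofReal_ne_top hC₂),
          lintegral_add_right _ measurable_const, lintegral_one]
    _ ≤ ENNReal.ofReal C₁ * C₂ * (J + profileMeasure ν univ) := by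
        gcongr
        exact hν.lintegral_lintegral_Ioc_le h.measurable_kernelDensity hx
    _ ≤ ENNReal.ofReal C₁ * C₂ * ((1 + profileMeasure ν univ) * (J + 1)) := by
        gcongr
        rw [add_mul, one_mul, mul_add, mul_one]
        exact add_le_add le_self_add le_add_self
    _ = C * (J + 1) := by rw [hC]; ring
    _ ≤ ENNReal.ofReal (C.toReal + 1) * (J + 1) := by
        gcongr
        rw [ENNReal.ofReal_add ENNReal.toReal_nonneg zero_le_one, ENNReal.ofReal_toReal hCtop]
        exact le_self_add

/-! ### The lower estimate -/

/-- The integral over a circle is at least that over the arc `|θ| < ε (1 - ρ)`. -/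
lemma UpperDoubling.exists_le_lintegral_circle (hω : ω ∈ UpperDoubling) (hp : 0 ≤ p) (N : ℕ) :
    ∃ c : ℝ, 0 < c ∧ ∀ ρ ∈ Ico (0 : ℝ) 1, ENNReal.ofReal (c * ((1 - ρ) * kernelSize p N ω (1 - ρ))) ≤
      ∫⁻ θ in Ioo (-Real.pi) Real.pi,
        ‖(1 - polarPoint (ρ, θ)) ^ N * kernelFun ω (polarPoint (ρ, θ))‖ₑ ^ p := by
  have h := hω.1
  obtain ⟨c, ε, hc, hε, hε1, hB⟩ := exists_le_norm_kernelFun hω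
  refine ⟨c ^ p * (2 * ε), by positivity, fun ρ hρ => ?_⟩
  have hx : 0 < 1 - ρ := by linarith [hρ.2]
  have hT := h.tailAt_pos hx
  have hS := (h.kernelSize_pos (p := p) (N := N) hx).le
  have hsub : Ioo (-(ε * (1 - ρ))) (ε * (1 - ρ)) ⊆ Ioo (-Real.pi) Real.pi := by
    have : ε * (1 - ρ) ≤ Real.pi := by nlinarith [Real.pi_gt_three, hρ.1]
    exact Ioo_subset_Ioo (by linarith) this
  calc ENNReal.ofReal (c ^ p * (2 * ε) * ((1 - ρ) * kernelSize p N ω (1 - ρ)))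
      = ∫⁻ _ in Ioo (-(ε * (1 - ρ))) (ε * (1 - ρ)),
          ENNReal.ofReal (c ^ p * kernelSize p N ω (1 - ρ)) := by
        rw [setLIntegral_const, Real.volume_Ioo, ← ENNReal.ofReal_mul (by positivity)]
        congr 1
        ring
    _ ≤ ∫⁻ θ in Ioo (-(ε * (1 - ρ))) (ε * (1 - ρ)),
          ‖(1 - polarPoint (ρ, θ)) ^ N * kernelFun ω (polarPoint (ρ, θ))‖ₑ ^ p := by
        refine setLIntegral_mono' measurableSet_Ioo fun θ hθ => ?_
        rw [← ofReal_norm, ENNReal.ofReal_rpow_of_nonneg (norm_nonneg _) hp, kernelSize,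
          ← Real.mul_rpow hc.le (by positivity)]
        refine ENNReal.ofReal_le_ofReal (Real.rpow_le_rpow (by positivity) ?_ hp)
        have h1 := hB ρ hρ θ (abs_lt.2 hθ).le
        have h2 := one_sub_le_norm_one_sub_polarPoint hρ.1 θ
        rw [norm_mul, norm_pow]
        calc c * ((1 - ρ) ^ N / ((1 - ρ) * tailAt ω (1 - ρ)))
            = (1 - ρ) ^ N * (c / ((1 - ρ) * tailAt ω (1 - ρ))) := by ring
          _ ≤ ‖1 - polarPoint (ρ, θ)‖ ^ N * ‖kernelFun ω (polarPoint (ρ, θ))‖ := by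
              gcongr
              exact h1
    _ ≤ _ := lintegral_mono_set hsub

/-- For a lower doubling weight, a fixed proportion of the mass of `[t, 1)` lies in the hyperbolically
bounded interval `[t, 1 - (1 - t) / K)`. -/
lemma LowerDoubling.exists_tail_le_mul_measure (hν : ν ∈ LowerDoubling) :
    ∃ r₀ K D : ℝ, r₀ ∈ Ico (1 / 2 : ℝ) 1 ∧ 1 < K ∧ 0 < D ∧ ∀ t ∈ Ioo r₀ 1,
      ENNReal.ofReal (tail ν t) ≤
        ENNReal.ofReal D * profileMeasure ν (Ico t (1 - (1 - t) / K)) := by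
  obtain ⟨h, K, C, hK, hC, hev⟩ := hν
  have hfin := h.isFiniteMeasure
  obtain ⟨r₁, hr₁, hsub⟩ := (mem_nhdsLT_iff_exists_Ioo_subset' (zero_lt_one' ℝ)).1 hev
  have hr₁' : r₁ < 1 := hr₁
  refine ⟨max r₁ (1 / 2), K, C / (C - 1), ⟨le_max_right _ _, max_lt hr₁' (by norm_num)⟩, hK,
    div_pos (by linarith) (by linarith), fun t ht => ?_⟩
  have htr : r₁ < t := (le_max_left _ _).trans_lt ht.1
  have ht2 : (1 / 2 : ℝ) < t := (le_max_right _ _).trans_lt ht.1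
  have h1 : C * tail ν (1 - (1 - t) / K) ≤ tail ν t := hsub ⟨htr, ht.2⟩
  have h1t : 0 < 1 - t := by linarith [ht.2]
  have hdiv : (1 - t) / K ≤ 1 - t := div_le_self h1t.le hK.le
  have hdiv0 : 0 < (1 - t) / K := div_pos h1t (by linarith)
  have hm : profileMeasure ν (Ico t (1 - (1 - t) / K)) =
      ENNReal.ofReal (tail ν t - tail ν (1 - (1 - t) / K)) := by
    have e : Ico t (1 - (1 - t) / K) = Ici t \ Ici (1 - (1 - t) / K) := by
      rw [Ici_sdiff_Ici]
    rw [e, measure_sdiff (Ici_subset_Ici.2 (by linarith)) measurableSet_Ici.nullMeasurableSet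
      (measure_ne_top _ _), h.profileMeasure_Ici ⟨by linarith, ht.2.le⟩,
      h.profileMeasure_Ici ⟨by linarith, by linarith⟩,
      ENNReal.ofReal_sub _ (h.tail_nonneg ⟨by linarith, by linarith⟩)]
  rw [hm, ← ENNReal.ofReal_mul (div_nonneg (by linarith) (by linarith))]
  refine ENNReal.ofReal_le_ofReal ?_
  have hC1 : 0 < C - 1 := by linarith
  rw [div_mul_eq_mul_div, le_div_iff₀ hC1]
  linarith

namespace UpperDoubling

/-- The part of the integral over `[0, r₀]` is bounded. -/
lemma lintegral_Ioc_tail_mul_kernelDensity_ne_top (hω : ω ∈ UpperDoubling) (hν : IsRadialWeight ν)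
    {r₀ : ℝ} (hr₀ : r₀ ∈ Ico (0 : ℝ) 1) :
    ∫⁻ t in Ioc 0 r₀, ENNReal.ofReal (tail ν t) * kernelDensity p N ω t ≠ ∞ := by
  have := hω.1.ofReal_kernelBound (p := p) (N := N) hν hr₀
  intro htop
  rw [htop, top_add] at this
  exact ENNReal.ofReal_ne_top this

/-- Beyond `r₀` the tail of `ν` is replaced by the mass of the intervals `[t, 1 - (1 - t) / K)`; for
`s` in such an interval and `t < x`, the distances `1 - t` and `1 - x s` are comparable. -/
lemma exists_lintegral_Ioc_le (hω : ω ∈ UpperDoubling) (hν : ν ∈ LowerDoubling) (hp : 0 ≤ p) (N : ℕ) :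
    ∃ C : ℝ≥0∞, C ≠ ∞ ∧ ∀ x ∈ Ico (0 : ℝ) 1,
      ∫⁻ t in Ioc 0 x, ENNReal.ofReal (tail ν t) * kernelDensity p N ω t ≤
        C * ((∫⁻ s, ENNReal.ofReal (s * ((1 - x * s) * kernelSize p N ω (1 - x * s)))
          ∂(profileMeasure ν)) + 1) := by
  have h := hω.1
  have hfin := hν.1.isFiniteMeasure
  obtain ⟨r₀, K, D, hr₀, hK, hD, hmass⟩ := LowerDoubling.exists_tail_le_mul_measure hν
  obtain ⟨C, hC, hS⟩ := exists_kernelSize_le hω hp N (A := K + 1) (by linarith)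
  have hK0 : 0 < K := by linarith
  have hC0 : 0 < C := by linarith
  have hr₀0 : (1 / 2 : ℝ) ≤ r₀ := hr₀.1
  set B : ℝ≥0∞ := ∫⁻ t in Ioc 0 r₀, ENNReal.ofReal (tail ν t) * kernelDensity p N ω t with hB
  have hBtop : B ≠ ∞ :=
    lintegral_Ioc_tail_mul_kernelDensity_ne_top hω hν.1 ⟨by linarith, hr₀.2⟩
  set M : ℝ≥0∞ := ENNReal.ofReal D * ENNReal.ofReal (2 * C * K) with hM
  have hMtop : M ≠ ∞ := ENNReal.mul_ne_top ENNReal.ofReal_ne_top ENNReal.ofReal_ne_top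
  refine ⟨B + M, ENNReal.add_ne_top.2 ⟨hBtop, hMtop⟩, fun x hx => ?_⟩
  set J : ℝ≥0∞ := ∫⁻ s, ENNReal.ofReal (s * ((1 - x * s) * kernelSize p N ω (1 - x * s)))
    ∂(profileMeasure ν) with hJ
  set g : ℝ → ℝ≥0∞ := kernelDensity p N ω with hgdef
  have hg : Measurable g := h.measurable_kernelDensity
  have hmeas : Measurable (Function.uncurry fun t s : ℝ =>
      (Ico t (1 - (1 - t) / K)).indicator (fun _ => g t) s) := by
    have e : (Function.uncurry fun t s : ℝ =>
        (Ico t (1 - (1 - t) / K)).indicator (fun _ => g t) s) =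
        ({q : ℝ × ℝ | q.1 ≤ q.2} ∩ {q : ℝ × ℝ | q.2 < 1 - (1 - q.1) / K}).indicator
          fun q => g q.1 := by
      funext q
      simp only [Function.uncurry, indicator, mem_Ico]
      rfl
    rw [e]
    exact (hg.comp measurable_fst).indicator ((measurableSet_le measurable_fst measurable_snd).inter
      (measurableSet_lt measurable_snd (by fun_prop)))
  have hfar : ∫⁻ t in Ioc r₀ x, ENNReal.ofReal (tail ν t) * g t ≤ M * J := by
    calc ∫⁻ t in Ioc r₀ x, ENNReal.ofReal (tail ν t) * g t
        ≤ ∫⁻ t in Ioc r₀ x, ENNReal.ofReal D *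
            (∫⁻ s, (Ico t (1 - (1 - t) / K)).indicator (fun _ => g t) s ∂(profileMeasure ν)) := by
          refine setLIntegral_mono' measurableSet_Ioc fun t ht => ?_
          rw [lintegral_indicator measurableSet_Ico, setLIntegral_const, mul_comm (g t), ← mul_assoc]
          gcongr
          exact hmass t ⟨ht.1, ht.2.trans_lt hx.2⟩
      _ = ENNReal.ofReal D * ∫⁻ s, (∫⁻ t in Ioc r₀ x,
            (Ico t (1 - (1 - t) / K)).indicator (fun _ => g t) s) ∂(profileMeasure ν) := by
          rw [lintegral_const_mul' _ _ ENNReal.ofReal_ne_top]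
          congr 1
          exact lintegral_lintegral_swap hmeas.aemeasurable
      _ ≤ ENNReal.ofReal D * ∫⁻ s, ENNReal.ofReal (2 * C * K) *
            ENNReal.ofReal (s * ((1 - x * s) * kernelSize p N ω (1 - x * s)))
            ∂(profileMeasure ν) := by
          refine mul_le_mul_right (lintegral_mono_ae ?_) _
          filter_upwards [IsRadialWeight.ae_profileMeasure] with s hs
          have hxs : x * s < 1 := mul_lt_one_of_nonneg_of_lt_one_left hx.1 hx.2 hs.2.le
          have hxs0 : 0 < 1 - x * s := by linarith
          have hSpos := (h.kernelSize_pos (p := p) (N := N) hxs0).le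
          have h1s : 0 < 1 - s := by linarith [hs.2]
          have hle : 1 - s ≤ 1 - x * s := by nlinarith [hs.1, hx.2]
          have hpt : ∀ t ∈ Ioc r₀ x, (Ico t (1 - (1 - t) / K)).indicator (fun _ => g t) s ≤
              (Ioc (1 - K * (1 - s)) 1).indicator
                (fun _ => ENNReal.ofReal (2 * s * (C * kernelSize p N ω (1 - x * s)))) t := by
            intro t ht
            by_cases hst : s ∈ Ico t (1 - (1 - t) / K)
            · have ht1 : t < 1 := ht.2.trans_lt hx.2
              have htK : 1 - t < K * (1 - s) := by
                have := hst.2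
                have h3 : (1 - t) / K < 1 - s := by linarith
                rw [div_lt_iff₀ hK0] at h3
                linarith
              have htm : t ∈ Ioc (1 - K * (1 - s)) 1 := ⟨by linarith, ht1.le⟩
              have ht0 : t ∈ Ico (0 : ℝ) 1 := ⟨by linarith [ht.1], ht1⟩
              rw [indicator_of_mem hst, indicator_of_mem htm, hgdef, kernelDensity,
                indicator_of_mem ht0]
              refine ENNReal.ofReal_le_ofReal ?_
              have hcomp1 : 1 - t ≤ (K + 1) * (1 - x * s) := by nlinarith
              have hcomp2 : 1 - x * s ≤ (K + 1) * (1 - t) := by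
                have h4 : 1 - x * s ≤ (1 - t) + (1 - t) := by
                  nlinarith [hst.1, ht.2, hs.1, hs.2, hx.2]
                nlinarith
              have h5 := hS (1 - t) (1 - x * s) (by linarith) hxs0 hcomp1 hcomp2
              have h6 : 1 ≤ 2 * s := by linarith [hst.1, ht.1]
              have h7 : 0 ≤ C * kernelSize p N ω (1 - x * s) := mul_nonneg hC0.le hSpos
              nlinarith
            · rw [indicator_of_notMem hst]
              exact bot_le
          calc ∫⁻ t in Ioc r₀ x, (Ico t (1 - (1 - t) / K)).indicator (fun _ => g t) s
              ≤ ∫⁻ t in Ioc r₀ x, (Ioc (1 - K * (1 - s)) 1).indicator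
                (fun _ => ENNReal.ofReal (2 * s * (C * kernelSize p N ω (1 - x * s)))) t :=
                setLIntegral_mono' measurableSet_Ioc hpt
            _ ≤ ∫⁻ t, (Ioc (1 - K * (1 - s)) 1).indicator
                (fun _ => ENNReal.ofReal (2 * s * (C * kernelSize p N ω (1 - x * s)))) t :=
                setLIntegral_le_lintegral _ _
            _ = ENNReal.ofReal (2 * s * (C * kernelSize p N ω (1 - x * s)) * (K * (1 - s))) := by
                have hs0 := hs.1
                rw [lintegral_indicator measurableSet_Ioc, setLIntegral_const, Real.volume_Ioc,
                  sub_sub_cancel, ← ENNReal.ofReal_mul (by positivity)]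
            _ ≤ ENNReal.ofReal (2 * C * K) *
                ENNReal.ofReal (s * ((1 - x * s) * kernelSize p N ω (1 - x * s))) := by
                rw [← ENNReal.ofReal_mul (by positivity)]
                refine ENNReal.ofReal_le_ofReal ?_
                have hs0 := hs.1
                calc 2 * s * (C * kernelSize p N ω (1 - x * s)) * (K * (1 - s))
                    ≤ 2 * s * (C * kernelSize p N ω (1 - x * s)) * (K * (1 - x * s)) := by gcongr
                  _ = _ := by ring
      _ = M * J := by
          rw [lintegral_const_mul' _ _ ENNReal.ofReal_ne_top, ← mul_assoc]
  have hsub : Ioc 0 x ⊆ Ioc 0 r₀ ∪ Ioc r₀ x := fun t ht => by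
    rcases le_or_gt t r₀ with h1 | h1
    · exact Or.inl ⟨ht.1, h1⟩
    · exact Or.inr ⟨h1, ht.2⟩
  calc ∫⁻ t in Ioc 0 x, ENNReal.ofReal (tail ν t) * g t ≤ B + M * J :=
        (lintegral_mono_set hsub).trans ((lintegral_union_le _ _ _).trans (by gcongr))
    _ ≤ B * (J + 1) + M * (J + 1) := by
        gcongr
        · exact le_mul_of_one_le_right' le_add_self
        · exact le_self_add
    _ = _ := by ring

/-- The mass of `ν` in a fixed annulus gives a positive lower bound that is uniform in `x`. -/
lemma exists_pos_le_lintegral (hω : ω ∈ UpperDoubling) (hν : ν ∈ LowerDoubling) (hp : 0 ≤ p) (N : ℕ) :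
    ∃ C : ℝ≥0∞, C ≠ ∞ ∧ ∀ x ∈ Ico (0 : ℝ) 1,
      1 ≤ C * ∫⁻ s, ENNReal.ofReal (s * ((1 - x * s) * kernelSize p N ω (1 - x * s)))
          ∂(profileMeasure ν) := by
  have h := hω.1
  have hfin := hν.1.isFiniteMeasure
  obtain ⟨r₀, K, D, hr₀, hK, hD, hmass⟩ := LowerDoubling.exists_tail_le_mul_measure hν
  have hr₀0 : (1 / 2 : ℝ) ≤ r₀ := hr₀.1
  have hr₀1 : r₀ < 1 := hr₀.2
  set t : ℝ := (1 + r₀) / 2 with ht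
  have htm : t ∈ Ioo r₀ 1 := ⟨by linarith, by linarith⟩
  have h1 := hmass t htm
  set y : ℝ := (1 - t) / K with hy
  have hy0 : 0 < y := div_pos (by linarith [htm.2]) (by linarith)
  set m := profileMeasure ν (Ico t (1 - y)) with hm
  have hm0 : m ≠ 0 := by
    intro h0
    rw [h0, mul_zero] at h1
    have := hν.1.tail_pos t ⟨by linarith, htm.2⟩
    exact absurd h1 (by simpa using this)
  have hmtop : m ≠ ∞ := measure_ne_top _ _
  have hy1 : y ≤ 1 := (div_le_self (by linarith [htm.2]) hK.le).trans (by linarith)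
  obtain ⟨C, hC, hS⟩ := exists_kernelSize_le hω hp N (A := 1 / y) (by positivity)
  have hone := h.kernelSize_pos (p := p) (N := N) one_pos
  have hC0 : 0 < C := by linarith
  set c : ℝ := 1 / 2 * (y * (kernelSize p N ω 1 / C)) with hc
  have hc0 : 0 < c := by positivity
  have hcm0 : ENNReal.ofReal c * m ≠ 0 := mul_ne_zero (by simpa using hc0) hm0
  have hcmtop : ENNReal.ofReal c * m ≠ ∞ := ENNReal.mul_ne_top ENNReal.ofReal_ne_top hmtop
  refine ⟨(ENNReal.ofReal c * m)⁻¹, ENNReal.inv_ne_top.2 hcm0, fun x hx => ?_⟩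
  rw [← ENNReal.inv_mul_cancel hcm0 hcmtop]
  refine mul_le_mul_right ?_ _
  calc ENNReal.ofReal c * m = ∫⁻ _ in Ico t (1 - y), ENNReal.ofReal c ∂(profileMeasure ν) := by
        rw [setLIntegral_const]
    _ ≤ ∫⁻ s in Ico t (1 - y), ENNReal.ofReal (s * ((1 - x * s) * kernelSize p N ω (1 - x * s)))
          ∂(profileMeasure ν) := by
        refine setLIntegral_mono' measurableSet_Ico fun s hs => ENNReal.ofReal_le_ofReal ?_
        have hs0 : (1 / 2 : ℝ) ≤ s := by linarith [hs.1]
        have hxs : y ≤ 1 - x * s := by nlinarith [hs.2, hx.2]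
        have hxs1 : 1 - x * s ≤ 1 := by nlinarith [hx.1]
        have hxs0 : 0 < 1 - x * s := by linarith
        have h3 := hS 1 (1 - x * s) one_pos hxs0
          (by rw [div_mul_eq_mul_div, le_div_iff₀ hy0]; linarith)
          (by rw [mul_one, le_div_iff₀ hy0]; nlinarith)
        have h4 : kernelSize p N ω 1 / C ≤ kernelSize p N ω (1 - x * s) := by
          rw [div_le_iff₀ hC0]; linarith
        rw [hc]
        gcongr
    _ ≤ _ := setLIntegral_le_lintegral _ _

theorem exists_le_modifiedKernelIntegral (hω : ω ∈ UpperDoubling) (hν : ν ∈ LowerDoubling)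
    (hp : 0 ≤ p) (N : ℕ) :
    ∃ c : ℝ, 0 < c ∧ ∀ z ∈ Metric.ball (0 : ℂ) 1,
      ENNReal.ofReal (c * kernelBound p N ω ν ‖z‖) ≤ modifiedKernelIntegral p N ω ν z := by
  have h := hω.1
  obtain ⟨c, hc, hcirc⟩ := exists_le_lintegral_circle hω hp N
  obtain ⟨C₁, hC₁, h1⟩ := exists_lintegral_Ioc_le hω hν hp N
  obtain ⟨C₂, hC₂, h2⟩ := exists_pos_le_lintegral hω hν hp N
  set C : ℝ := (C₁ * (1 + C₂) + C₂).toReal + 1 with hC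
  have hC0 : 0 < C := by positivity
  have hCtop : C₁ * (1 + C₂) + C₂ ≠ ∞ := ENNReal.add_ne_top.2
    ⟨ENNReal.mul_ne_top hC₁ (ENNReal.add_ne_top.2 ⟨ENNReal.one_ne_top, hC₂⟩), hC₂⟩
  have hpi := Real.pi_pos
  refine ⟨c / Real.pi / C, by positivity, fun z hz => ?_⟩
  have hx : ‖z‖ ∈ Ico (0 : ℝ) 1 := ⟨norm_nonneg z, mem_ball_zero_iff.1 hz⟩
  set x := ‖z‖ with hxdef
  set J : ℝ≥0∞ := ∫⁻ s, ENNReal.ofReal (s * ((1 - x * s) * kernelSize p N ω (1 - x * s)))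
    ∂(profileMeasure ν) with hJ
  have hbound : ENNReal.ofReal (kernelBound p N ω ν x) ≤ ENNReal.ofReal C * J := by
    rw [h.ofReal_kernelBound hν.1 hx]
    calc _ ≤ C₁ * (J + 1) + 1 := by
          gcongr
          exact h1 x hx
      _ ≤ C₁ * (J + C₂ * J) + C₂ * J := by
          gcongr
          · exact h2 x hx
          · exact h2 x hx
      _ = (C₁ * (1 + C₂) + C₂) * J := by ring
      _ ≤ ENNReal.ofReal C * J := by
          gcongr
          rw [hC, ENNReal.ofReal_add ENNReal.toReal_nonneg zero_le_one, ENNReal.ofReal_toReal hCtop]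
          exact le_self_add
  have hJle : ENNReal.ofReal (c / Real.pi) * J ≤ modifiedKernelIntegral p N ω ν z := by
    rw [modifiedKernelIntegral_eq hω hν.1 hz, hJ, ← lintegral_const_mul' _ _ ENNReal.ofReal_ne_top]
    refine lintegral_mono_ae ?_
    filter_upwards [IsRadialWeight.ae_profileMeasure] with s hs
    have hρ : x * s ∈ Ico (0 : ℝ) 1 :=
      ⟨mul_nonneg hx.1 hs.1, mul_lt_one_of_nonneg_of_lt_one_left hx.1 hx.2 hs.2.le⟩
    refine le_trans (le_of_eq ?_) (mul_le_mul_right (hcirc _ hρ) _)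
    rw [← ENNReal.ofReal_mul (by positivity), ← ENNReal.ofReal_mul (div_nonneg hs.1 hpi.le)]
    congr 1
    ring
  calc ENNReal.ofReal (c / Real.pi / C * kernelBound p N ω ν x)
      = ENNReal.ofReal (c / Real.pi / C) * ENNReal.ofReal (kernelBound p N ω ν x) :=
        ENNReal.ofReal_mul (by positivity)
    _ ≤ ENNReal.ofReal (c / Real.pi / C) * (ENNReal.ofReal C * J) := by gcongr
    _ = ENNReal.ofReal (c / Real.pi) * J := by
        rw [← mul_assoc, ← ENNReal.ofReal_mul (by positivity), div_mul_cancel₀ _ hC0.ne']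
    _ ≤ _ := hJle

end UpperDoubling

end RadialBergman

end

theorem lemma4 (p : ℝ) (hp : 2 ≤ p) (N : ℕ) (ω ν : ℝ → ℝ)
    (hω : ω ∈ RadialBergman.UpperDoubling) (hν : RadialBergman.IsRadialWeight ν) :
    (∃ C : ℝ, 0 < C ∧ ∀ z ∈ Metric.ball (0 : ℂ) 1,
      RadialBergman.modifiedKernelIntegral p N ω ν z ≤
        ENNReal.ofReal (C * RadialBergman.kernelBound p N ω ν ‖z‖)) ∧
    (ν ∈ RadialBergman.TwoSidedDoubling →
      ∃ c C : ℝ, 0 < c ∧ 0 < C ∧ ∀ z ∈ Metric.ball (0 : ℂ) 1,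
        ENNReal.ofReal (c * RadialBergman.kernelBound p N ω ν ‖z‖) ≤
          RadialBergman.modifiedKernelIntegral p N ω ν z ∧
        RadialBergman.modifiedKernelIntegral p N ω ν z ≤
          ENNReal.ofReal (C * RadialBergman.kernelBound p N ω ν ‖z‖)) := by
  have hp0 : 0 ≤ p := by linarith
  obtain ⟨C, hC, hupper⟩ :=
    RadialBergman.UpperDoubling.exists_modifiedKernelIntegral_le hω hν hp0 N
  refine ⟨⟨C, hC, hupper⟩, fun hνD => ?_⟩
  obtain ⟨c, hc, hlower⟩ :=
    RadialBergman.UpperDoubling.exists_le_modifiedKernelIntegral hω hνD.2 hp0 N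
  exact ⟨c, C, hc, hC, fun z hz => ⟨hlower z hz, hupper z hz⟩⟩
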